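/- Let $\mathcal C_k$ be the circular graph with vertex set $\{1,\dots,k\}$ and edges $\{n,n+1\}$ for $1\le n<k$ and $\{k,1\}$. In the meteor process on $\mathcal C_k$ every vertex $v$ carries a mass $M^v_t\ge 0$ at time $t\ge 0$, and independent Poisson processes $N^v$ of intensity $1$, one for each vertex and independent of the initial masses, give the times of meteor hits. When $v$ is hit at time $t$, the mass $M^v_{t-}$ present there is removed from $v$ and half of it is added to each of the two neighbors of $v$; the masses do not change otherwise. Assume that $\sum_{v=1}^k M^v_0=k$ almost surely and that the process is in the stationary regime, i.e. the distribution of $(M^v_0)_{v}$ is stationary for the process. Let $i,j\ge 1$ and $k\ge i+j+5$, and let $A^k_{i,j}$ be the event that $M^2_0=M^{i+3}_0=M^{i+j+4}_0=0$ and $M^n_0>0$ for $n=3,4,\dots,i+2,\ i+4,\dots,i+j+3$. (That is, $2$ is a crater, a site with zero mass, and the gaps between this crater and the next two craters have sizes $i$ and $j$.) Then $$\mathbb P(A^k_{i,j})=\frac{2^{i+j}}{(i+j+5)!}\Bigl[(i+j+4)\Bigl(j\tbinom{i+j+1}{i-1}+(j+1)\tbinom{i+j+1}{i}+(i+1)\tbinom{i+j+1}{i+1}+i\tbinom{i+j+1}{i+2}-2(i+j+1)\Bigr)+ij\tbinom{i+j+4}{i+2}\Bigr].$$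 -/

import Mathlib

open MeasureTheory ProbabilityTheory Filter Topology
open scoped NNReal

namespace Meteor

/-- `N` is a Poisson process of intensity `1` on `[0, ∞)`: it starts at `0`, has nondecreasing
right-continuous paths, independent increments, and Poisson distributed increments with
parameter equal to the elapsed time. -/
structure IsPoissonProcess {Ω : Type*} [MeasurableSpace Ω] (P : Measure Ω)
    (N : ℝ≥0 → Ω → ℕ) : Prop where
  measurable : ∀ t, Measurable (N t)
  start : ∀ᵐ ω ∂P, N 0 ω = 0
  monotone : ∀ᵐ ω ∂P, Monotone fun t => N t ω
  rightContinuous : ∀ᵐ ω ∂P, ∀ t, ContinuousWithinAt (fun s => N s ω) (Set.Ici t) t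
  indepIncrements : HasIndepIncrements N P
  increment_law : ∀ s t, s ≤ t → P.map (fun ω => N t ω - N s ω) = poissonMeasure (t - s)

/-- The nondecreasing counting path `f` jumps at time `t`. -/
def JumpsAt (f : ℝ≥0 → ℕ) (t : ℝ≥0) : Prop :=
  0 < t ∧ ∀ s, s < t → f s < f t

open Classical in
/-- The path `m t v` (mass at `v` at time `t`) evolves on the graph `G` according to meteor hits
counted by `N v t`. The mass at `v` is constant over any time interval during which
neither `v` nor one of its neighbors is hit. At any time `t > 0` the masses `m' v` just before `t`
exist; a site that is hit at time `t` loses the mass it has just before `t`, and that mass is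
shared equally among its neighbors. -/
def FollowsHits {V : Type*} [Fintype V] (G : SimpleGraph V)
    (N : V → ℝ≥0 → ℕ) (m : ℝ≥0 → V → ℝ) : Prop :=
  (∀ v s t, s ≤ t → (∀ x, x = v ∨ G.Adj v x → N x s = N x t) → m s v = m t v) ∧
  ∀ t, 0 < t → ∃ m' : V → ℝ,
    (∀ v, Tendsto (fun s => m s v) (𝓝[<] t) (𝓝 (m' v))) ∧
    ∀ v, m t v = (if JumpsAt (N v) t then 0 else m' v) +
      ∑ x : V, if G.Adj v x ∧ JumpsAt (N x) t then m' x / (G.degree x : ℝ) else 0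

/-- `M` is a meteor process on the graph `G`, driven by the family `N` of
meteor hits: the `N v` are jointly independent Poisson processes of intensity `1`, independent of
the nonnegative initial masses, and almost surely the masses evolve according to the hits. -/
structure IsMeteorProcess {V : Type*} [Fintype V] (G : SimpleGraph V)
    {Ω : Type*} [MeasurableSpace Ω] (P : Measure Ω)
    (N : V → ℝ≥0 → Ω → ℕ) (M : ℝ≥0 → Ω → V → ℝ) : Prop where
  poisson : ∀ v, IsPoissonProcess P (N v)
  indep : iIndepFun (fun v ω t => N v t ω) P
  indep_initial : IndepFun (M 0) (fun ω v t => N v t ω) P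
  measurable_mass : ∀ t, Measurable (M t)
  initial_nonneg : ∀ᵐ ω ∂P, ∀ v, 0 ≤ M 0 ω v
  evolution : ∀ᵐ ω ∂P, FollowsHits G (fun v t => N v t ω) (fun t => M t ω)

/-- The mass process `M` is in the stationary regime: the distribution of the
masses at time `0` is invariant, that is, it is the distribution of the masses at all times. -/
def IsStationaryRegime {V : Type*} {Ω : Type*} [MeasurableSpace Ω] (P : Measure Ω)
    (M : ℝ≥0 → Ω → V → ℝ) : Prop :=
  ∀ t, IdentDistrib (M t) (M 0) P P

/-- The vertex of the circular graph on `k` vertices with label `n`; labels are read modulo `k`,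
so that the vertices are those labelled `1, 2, …, k`. -/
def site (k : ℕ) [NeZero k] (n : ℕ) : Fin k := Fin.ofNat k n

/-- The mass configurations for which sites `2`, `i + 3`, `i + j + 4` are craters
and the sites `3, …, i + 2` and `i + 4, …, i + j + 3` between them are not. -/
def craterGaps (k : ℕ) [NeZero k] (i j : ℕ) : Set (Fin k → ℝ) :=
  {m | m (site k 2) = 0 ∧ m (site k (i + 3)) = 0 ∧ m (site k (i + j + 4)) = 0 ∧
    (∀ n, 3 ≤ n → n ≤ i + 2 → 0 < m (site k n)) ∧
    ∀ n, i + 4 ≤ n → n ≤ i + j + 3 → 0 < m (site k n)}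

end Meteor

/-! By stationarity the event may be examined at any time `t` instead of time `0`. Consider the last
hit up to time `t` of each vertex. A vertex hit strictly later than both neighbors was emptied at
that hit and has received nothing since, so it is a crater. A vertex with a neighbor hit strictly
later than itself carries mass, provided adjacent vertices are never both empty. Hence, away from
ties, craters are exactly the local maxima of the last-hit times (`FollowsHits.eq_zero`,
`FollowsHits.pos`).

Adjacent empty vertices are excluded as follows. Along the dynamics an edge with mass never becomes
empty, so by stationarity emptiness of an edge at time `0` persists almost surely. If a neighbor of
the empty edge were occupied, a single hit there, independent of the initial masses and of positive
probability, would destroy the emptiness. Thus emptiness spreads around the cycle, against the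
positive total mass (`IsMeteorProcess.ae_edgePos`).

The last-hit times of the sites `1, …, i + j + 5` are independent and identically distributed; two
of them agree with probability at most `exp (-t)`. Given no ties all orders are equally likely.
Letting `t` tend to infinity, the probability becomes the proportion of permutations of `i + j + 5`
numbers whose peaks are exactly at the three prescribed places
(`IsMeteorProcess.factorial_mul_craterGaps`).

These permutations are counted by removing the maximum: it stands at an end or at a peak, and splits
the permutation into two independent pieces with fewer peaks (`peakCount_add_two`). Solving the
recursion for zero, one, two and three peaks gives the formula. -/

/-! ### Recursion for permutations with prescribed peaks -/

/-- Interior local maxima of the list `l`, whose entries sit at positions `a, a + 1, …`, are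
exactly at the positions satisfying `P`. -/
def HasPeaks (P : ℕ → Prop) (a : ℕ) (l : List ℕ) : Prop :=
  ∀ q, q + 2 < l.length →
    ((l.getD q 0 < l.getD (q + 1) 0 ∧ l.getD (q + 2) 0 < l.getD (q + 1) 0) ↔ P (a + q + 1))

/-- The pattern `P` allows the maximum of `n + 1` distinct numbers at the positions
`a, …, a + n` to be at position `a + k`. -/
def MaxAllowed (P : ℕ → Prop) (a n k : ℕ) : Prop :=
  (0 < k → k < n → P (a + k)) ∧ (2 ≤ k → ¬ P (a + k - 1)) ∧ (k + 2 ≤ n → ¬ P (a + k + 1))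

/-- An interior maximum is a peak and its neighbors are not; every window of three entries avoiding
the maximum lies wholly in `l₁` or in `l₂`. The conditions on the two sides are therefore
independent. -/
theorem hasPeaks_append (P : ℕ → Prop) (a m : ℕ) (l₁ l₂ : List ℕ)
    (h₁ : ∀ x ∈ l₁, x < m) (h₂ : ∀ x ∈ l₂, x < m) :
    HasPeaks P a (l₁ ++ m :: l₂) ↔
      MaxAllowed P a (l₁.length + l₂.length) l₁.length ∧ HasPeaks P a l₁ ∧
        HasPeaks P (a + l₁.length + 1) l₂ := by
  set L := l₁ ++ m :: l₂ with hL
  have hlen : L.length = l₁.length + l₂.length + 1 := by simp [hL]; ring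
  have e₁ : ∀ q, q < l₁.length → L.getD q 0 = l₁.getD q 0 := fun q hq =>
    List.getD_append _ _ _ _ hq
  have e₂ : L.getD l₁.length 0 = m := by
    rw [hL, List.getD_append_right _ _ _ _ le_rfl]; simp
  have e₃ : ∀ r, L.getD (l₁.length + 1 + r) 0 = l₂.getD r 0 := fun r => by
    rw [hL, List.getD_append_right _ _ _ _ (by omega),
      show l₁.length + 1 + r - l₁.length = r + 1 by omega, List.getD_cons_succ]
  have b₁ : ∀ q, q < l₁.length → l₁.getD q 0 < m := fun q hq => by
    rw [List.getD_eq_getElem _ _ hq]; exact h₁ _ (List.getElem_mem hq)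
  have b₂ : ∀ q, q < l₂.length → l₂.getD q 0 < m := fun q hq => by
    rw [List.getD_eq_getElem _ _ hq]; exact h₂ _ (List.getElem_mem hq)
  unfold HasPeaks MaxAllowed
  rw [hlen]
  generalize l₁.length = k at *
  generalize l₂.length = r at *
  generalize L.getD = f at *
  generalize l₁.getD = g at *
  generalize l₂.getD = h at *
  clear hL hlen h₁ h₂
  constructor
  · intro H
    refine ⟨⟨fun hk hr => ?_, fun hk hP => ?_, fun hk hP => ?_⟩, fun q hq => ?_, fun q hq => ?_⟩
    · obtain ⟨k, rfl⟩ : ∃ k', k = k' + 1 := ⟨k - 1, by omega⟩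
      refine (H k (by omega)).1 ⟨?_, ?_⟩
      · rw [e₂, e₁ _ (by omega)]; exact b₁ _ (by omega)
      · rw [e₂, show k + 2 = k + 1 + 1 + 0 by ring, e₃]; exact b₂ _ (by omega)
    · obtain ⟨k, rfl⟩ : ∃ k', k = k' + 2 := ⟨k - 2, by omega⟩
      have := ((H k (by omega)).2 (by simpa [add_assoc] using hP)).2
      rw [e₂, e₁ _ (by omega)] at this
      exact absurd this (b₁ _ (by omega)).le.not_gt
    · have := ((H k (by omega)).2 hP).1
      rw [e₂, show k + 1 = k + 1 + 0 by ring, e₃] at this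
      exact absurd this (b₂ _ (by omega)).le.not_gt
    · have := H q (by omega)
      rwa [e₁ _ (by omega), e₁ _ (by omega), e₁ _ (by omega)] at this
    · have := H (k + 1 + q) (by omega)
      rwa [e₃, show k + 1 + q + 1 = k + 1 + (q + 1) by ring, e₃,
        show k + 1 + q + 2 = k + 1 + (q + 2) by ring, e₃,
        show a + (k + 1 + q) + 1 = a + k + 1 + q + 1 by ring] at this
  · rintro ⟨⟨c₁, c₂, c₃⟩, H₁, H₂⟩ q hq
    -- The window starting at `q` lies left of the maximum, ends at it, is centered at it, starts at
    -- it, or lies to its right.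
    rcases lt_or_ge (q + 2) k with h1 | h1
    · rw [e₁ _ (by omega), e₁ _ (by omega), e₁ _ (by omega)]; exact H₁ q h1
    rcases h1.eq_or_lt with rfl | h1
    · refine iff_of_false ?_ (by simpa [add_assoc] using c₂ (by omega))
      rintro ⟨-, h2⟩
      rw [e₂, e₁ _ (by omega)] at h2
      exact absurd h2 (b₁ _ (by omega)).le.not_gt
    rcases (show k = q + 1 ∨ k ≤ q by omega) with rfl | h1
    · refine iff_of_true ⟨?_, ?_⟩ (c₁ (by omega) (by omega))
      · rw [e₂, e₁ _ (by omega)]; exact b₁ _ (by omega)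
      · rw [e₂, show q + 2 = q + 1 + 1 + 0 by ring, e₃]; exact b₂ _ (by omega)
    rcases h1.eq_or_lt with rfl | h1
    · refine iff_of_false ?_ (c₃ (by omega))
      rintro ⟨h2, -⟩
      rw [e₂, show k + 1 = k + 1 + 0 by ring, e₃] at h2
      exact absurd h2 (b₂ _ (by omega)).le.not_gt
    · obtain ⟨s, rfl⟩ : ∃ s, q = k + 1 + s := ⟨q - (k + 1), by omega⟩
      rw [e₃, show k + 1 + s + 1 = k + 1 + (s + 1) by ring, e₃,
        show k + 1 + s + 2 = k + 1 + (s + 2) by ring, e₃,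
        show a + (k + 1 + s) + 1 = a + k + 1 + s + 1 by ring]
      exact H₂ s (by omega)

/-- The lists in which each element of `S` occurs exactly once and which have no other elements. -/
noncomputable def arrangements (S : Finset ℕ) : Finset (List ℕ) := S.toList.permutations.toFinset

theorem mem_arrangements {S : Finset ℕ} {l : List ℕ} :
    l ∈ arrangements S ↔ l.Nodup ∧ l.toFinset = S := by
  rw [arrangements, List.mem_toFinset, List.mem_permutations]
  refine ⟨fun h => ⟨h.nodup_iff.2 S.nodup_toList, ?_⟩, fun h => ?_⟩
  · rw [List.toFinset_eq_of_perm _ _ h, Finset.toList_toFinset]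
  · exact List.perm_of_nodup_nodup_toFinset_eq h.1 S.nodup_toList (by simp [h.2])

theorem length_of_mem_arrangements {S : Finset ℕ} {l : List ℕ} (h : l ∈ arrangements S) :
    l.length = S.card := by
  obtain ⟨h1, h2⟩ := mem_arrangements.1 h
  rw [← h2, List.toFinset_card_of_nodup h1]

open Classical in
/-- The number of arrangements of `n` distinct numbers at the positions `a, …, a + n - 1` whose
peaks are exactly at the interior positions satisfying `P`, computed by the position of the
maximum. -/
noncomputable def peakCount (P : ℕ → Prop) : ℕ → ℕ → ℕ
  | _, 0 => 1
  | a, n + 1 => ∑ k : Fin (n + 1), if MaxAllowed P a n k then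
      n.choose k * (peakCount P a k * peakCount P (a + k + 1) (n - k)) else 0
termination_by _ n => n

theorem peakCount_zero (P : ℕ → Prop) (a : ℕ) : peakCount P a 0 = 1 := by
  rw [peakCount]

open Classical in
theorem peakCount_succ (P : ℕ → Prop) (a n : ℕ) :
    peakCount P a (n + 1) = ∑ k ∈ Finset.range (n + 1), if MaxAllowed P a n k then
      n.choose k * (peakCount P a k * peakCount P (a + k + 1) (n - k)) else 0 := by
  rw [peakCount, Finset.sum_range]

-- With the maximum of `S` removed, an arrangement amounts to the set `T` of entries to its left
-- together with arrangements of `T` and of the remaining entries. The counts depend on `T` only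
-- through its size, whence the binomial coefficient in the recursion.
open Classical in
theorem card_arrangements_hasPeaks (P : ℕ → Prop) (n : ℕ) : ∀ (a : ℕ) (S : Finset ℕ),
    S.card = n → ((arrangements S).filter (HasPeaks P a)).card = peakCount P a n := by
  induction n using Nat.strong_induction_on with
  | _ n ih =>
    intro a S hS
    rcases n with _ | n
    · obtain rfl : S = ∅ := Finset.card_eq_zero.1 hS
      rw [peakCount_zero, Finset.card_eq_one]
      refine ⟨[], ?_⟩
      ext l
      simp only [Finset.mem_filter, mem_arrangements, Finset.mem_singleton,
        List.toFinset_eq_empty_iff]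
      refine ⟨fun h => h.1.2, ?_⟩
      rintro rfl
      exact ⟨by simp, fun q hq => by simp at hq⟩
    · have hne : S.Nonempty := Finset.card_pos.1 (by omega)
      set m := S.max' hne with hm
      have hmS : m ∈ S := S.max'_mem hne
      have hlt : ∀ x ∈ S.erase m, x < m := fun x hx => S.lt_max'_of_mem_erase_max' hne hx
      have hcard : (S.erase m).card = n := by rw [Finset.card_erase_of_mem hmS, hS]; rfl
      have key : ((arrangements S).filter (HasPeaks P a)).card =
          (((S.erase m).powerset.filter (fun T => MaxAllowed P a n T.card)).sigma (fun T =>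
            ((arrangements T).filter (HasPeaks P a)) ×ˢ
              ((arrangements (S.erase m \ T)).filter (HasPeaks P (a + T.card + 1))))).card := by
        symm
        refine Finset.card_bij (fun x _ => x.2.1 ++ m :: x.2.2) ?_ ?_ ?_
        · rintro ⟨T, l₁, l₂⟩ hx
          simp only [Finset.mem_sigma, Finset.mem_filter, Finset.mem_powerset,
            Finset.mem_product] at hx
          obtain ⟨⟨hT, hc⟩, ⟨hl₁, hp₁⟩, hl₂, hp₂⟩ := hx
          have n₁ := length_of_mem_arrangements hl₁
          have n₂ := length_of_mem_arrangements hl₂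
          rw [Finset.card_sdiff_of_subset hT, hcard] at n₂
          have hTn := Finset.card_le_card hT
          rw [hcard] at hTn
          obtain ⟨d₁, f₁⟩ := mem_arrangements.1 hl₁
          obtain ⟨d₂, f₂⟩ := mem_arrangements.1 hl₂
          have g₁ : ∀ x, x ∈ l₁ ↔ x ∈ T := fun x => by rw [← f₁, List.mem_toFinset]
          have g₂ : ∀ x, x ∈ l₂ ↔ x ∈ S.erase m \ T := fun x => by rw [← f₂, List.mem_toFinset]
          refine Finset.mem_filter.2 ⟨mem_arrangements.2 ⟨?_, ?_⟩, ?_⟩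
          · rw [List.nodup_append, List.nodup_cons]
            refine ⟨d₁, ⟨fun h => ?_, d₂⟩, fun x hx y hy => ?_⟩
            · rw [g₂] at h; simp at h
            · rw [g₁] at hx
              rcases List.mem_cons.1 hy with rfl | hy
              · rintro rfl; exact absurd (hT hx) (by simp)
              · rw [g₂] at hy
                rintro rfl; exact (Finset.mem_sdiff.1 hy).2 hx
          · ext x
            simp only [List.mem_toFinset, List.mem_append, List.mem_cons, g₁, g₂,
              Finset.mem_sdiff, Finset.mem_erase]
            by_cases hxm : x = m
            · simp [hxm, hmS]
            · by_cases hxT : x ∈ T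
              · simp [hxT, (Finset.mem_erase.1 (hT hxT)).2]
              · simp [hxT, hxm]
          · rw [hasPeaks_append]
            · rw [n₁, n₂, show T.card + (n - T.card) = n by omega]
              exact ⟨hc, hp₁, hp₂⟩
            · intro x hx; exact hlt x (hT ((g₁ x).1 hx))
            · intro x hx; exact hlt x (Finset.mem_sdiff.1 ((g₂ x).1 hx)).1
        · rintro ⟨T, l₁, l₂⟩ hx ⟨T', l₁', l₂'⟩ hx' heq
          simp only [Finset.mem_sigma, Finset.mem_filter, Finset.mem_powerset,
            Finset.mem_product, mem_arrangements] at hx hx'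
          have m₁ : m ∉ l₁ := by
            rw [← List.mem_toFinset, hx.2.1.1.2]
            intro h; exact absurd (hx.1.1 h) (by simp)
          have m₂ : m ∉ l₁' := by
            rw [← List.mem_toFinset, hx'.2.1.1.2]
            intro h; exact absurd (hx'.1.1 h) (by simp)
          have hl : l₁ = l₁' ∧ l₂ = l₂' := by
            simp only at heq
            rw [List.append_eq_append_iff] at heq
            rcases heq with ⟨l, h1, h2⟩ | ⟨l, h1, h2⟩ <;> rcases l with _ | ⟨y, l⟩ <;> simp_all
          obtain ⟨rfl, rfl⟩ := hl
          obtain rfl : T = T' := by rw [← hx.2.1.1.2, ← hx'.2.1.1.2]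
          rfl
        · intro l hl
          obtain ⟨hl, hp⟩ := Finset.mem_filter.1 hl
          obtain ⟨d, f⟩ := mem_arrangements.1 hl
          have hml : m ∈ l := by rw [← List.mem_toFinset, f]; exact hmS
          obtain ⟨l₁, l₂, rfl⟩ := List.append_of_mem hml
          rw [List.nodup_append, List.nodup_cons] at d
          obtain ⟨d₁, ⟨dm, d₂⟩, dd⟩ := d
          have hmem : ∀ x, x ∈ S ↔ x ∈ l₁ ∨ x = m ∨ x ∈ l₂ := fun x => by
            rw [← f]; simp [or_left_comm]
          have g₁ : l₁.toFinset ⊆ S.erase m := fun x hx => by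
            rw [List.mem_toFinset] at hx
            exact Finset.mem_erase.2 ⟨dd x hx m (by simp), (hmem x).2 (Or.inl hx)⟩
          have g₂ : l₂.toFinset = S.erase m \ l₁.toFinset := by
            ext x
            rw [Finset.mem_sdiff, Finset.mem_erase, hmem, List.mem_toFinset, List.mem_toFinset]
            constructor
            · intro hx
              refine ⟨⟨?_, Or.inr (Or.inr hx)⟩, fun h => dd x h x (by simp [hx]) rfl⟩
              rintro rfl; exact dm hx
            · rintro ⟨⟨h1, h2 | h2 | h2⟩, h3⟩
              · exact absurd h2 h3
              · exact absurd h2 h1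
              · exact h2
          rw [hasPeaks_append] at hp
          · have hlen := length_of_mem_arrangements hl
            rw [hS, List.length_append, List.length_cons] at hlen
            rw [show l₁.length + l₂.length = n by omega] at hp
            refine ⟨⟨l₁.toFinset, l₁, l₂⟩, ?_, rfl⟩
            simp only [Finset.mem_sigma, Finset.mem_filter, Finset.mem_powerset,
              Finset.mem_product, mem_arrangements, List.toFinset_card_of_nodup d₁]
            exact ⟨⟨g₁, hp.1⟩, ⟨⟨d₁, trivial⟩, hp.2.1⟩, ⟨d₂, g₂⟩, hp.2.2⟩
          · intro x hx; exact hlt x (g₁ (List.mem_toFinset.2 hx))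
          · intro x hx
            have := g₂ ▸ List.mem_toFinset.2 hx
            exact hlt x (Finset.mem_sdiff.1 this).1
      rw [key, Finset.card_sigma, peakCount_succ, Finset.sum_filter]
      have h2 : ∀ T ∈ (S.erase m).powerset, (if MaxAllowed P a n T.card then
          (((arrangements T).filter (HasPeaks P a)) ×ˢ
            ((arrangements (S.erase m \ T)).filter (HasPeaks P (a + T.card + 1)))).card else 0) =
          (fun k => if MaxAllowed P a n k then
            peakCount P a k * peakCount P (a + k + 1) (n - k) else 0) T.card := by
        intro T hT
        rw [Finset.mem_powerset] at hT
        have hTn := Finset.card_le_card hT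
        rw [hcard] at hTn
        rw [Finset.card_product, ih T.card (by omega) a T rfl, ih (n - T.card) (by omega) _ _
          (by rw [Finset.card_sdiff_of_subset hT, hcard])]
      refine (Finset.sum_congr rfl h2).trans ?_
      rw [Finset.sum_powerset_apply_card (α := ℕ) (fun k => if MaxAllowed P a n k then
        peakCount P a k * peakCount P (a + k + 1) (n - k) else 0), hcard]
      refine Finset.sum_congr rfl fun k _ => ?_
      rw [smul_eq_mul]
      split_ifs <;> simp

open Classical in
/-- The count of arrangements with prescribed peaks splits by the position of the maximum: first,
last, or at one of the peaks. -/
theorem peakCount_add_two {P : ℕ → Prop} (hP : ∀ q, P q → ¬ P (q + 1)) (a n : ℕ) :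
    peakCount P a (n + 2) =
      (if 1 ≤ n → ¬ P (a + 1) then peakCount P (a + 1) (n + 1) else 0) +
      (if 1 ≤ n → ¬ P (a + n) then peakCount P a (n + 1) else 0) +
      ∑ k ∈ Finset.range n, if P (a + k + 1) then (n + 1).choose (k + 1) *
        (peakCount P a (k + 1) * peakCount P (a + k + 2) (n - k)) else 0 := by
  have h0 : MaxAllowed P a (n + 1) 0 ↔ (1 ≤ n → ¬ P (a + 1)) := by simp [MaxAllowed]
  have h1 : MaxAllowed P a (n + 1) (n + 1) ↔ (1 ≤ n → ¬ P (a + n)) := by simp [MaxAllowed]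
  rw [peakCount_succ, Finset.sum_range_succ, Finset.sum_range_succ', if_congr h0 rfl rfl,
    if_congr h1 rfl rfl]
  simp only [Nat.choose_zero_right, Nat.choose_self, peakCount_zero, one_mul, mul_one, add_zero,
    Nat.sub_self, Nat.sub_zero]
  have h2 : ∀ k ∈ Finset.range n, (if MaxAllowed P a (n + 1) (k + 1) then
      (n + 1).choose (k + 1) *
        (peakCount P a (k + 1) * peakCount P (a + (k + 1) + 1) (n + 1 - (k + 1))) else 0) =
      if P (a + k + 1) then (n + 1).choose (k + 1) *
        (peakCount P a (k + 1) * peakCount P (a + k + 2) (n - k)) else 0 := by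
    intro k hk
    rw [Finset.mem_range] at hk
    have : MaxAllowed P a (n + 1) (k + 1) ↔ P (a + k + 1) := by
      unfold MaxAllowed
      refine ⟨fun h => h.1 (by omega) (by omega), fun h => ⟨fun _ _ => h, fun hk h' => ?_,
        fun _ => hP _ h⟩⟩
      rw [show a + (k + 1) - 1 = a + k by omega] at h'
      exact hP _ h' h
    rw [if_congr this rfl rfl, show n + 1 - (k + 1) = n - k by omega,
      show a + (k + 1) + 1 = a + k + 2 by ring]
  rw [Finset.sum_congr rfl h2]
  ring

/-! ### Closed forms for zero, one, two and three peaks -/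

-- Without peaks the maximum is first or last, so each further entry doubles the count.
open Classical in
theorem peakCount_no_peak {P : ℕ → Prop} (hP : ∀ q, P q → ¬ P (q + 1)) (n : ℕ) : ∀ x : ℕ,
    (∀ q, x < q → q < x + n → ¬ P q) → peakCount P x (n + 1) = 2 ^ n := by
  induction n with
  | zero => intro x _; simp [peakCount_succ, MaxAllowed, peakCount_zero]
  | succ n ih =>
    intro x h
    rw [peakCount_add_two hP, if_pos fun _ => h _ (by omega) (by omega),
      if_pos fun _ => h _ (by omega) (by omega), ih _ fun q _ _ => h q (by omega) (by omega),
      ih _ fun q _ _ => h q (by omega) (by omega), Finset.sum_eq_zero]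
    · ring
    · intro k hk
      rw [Finset.mem_range] at hk
      exact if_neg (h _ (by omega) (by omega))

-- The maximum is first, last or at the peak. The first two cases are smaller instances whose
-- binomials add up by Pascal's rule; the third contributes `2 ^ a * 2 ^ b` times a binomial.
open Classical in
theorem peakCount_one_peak {P : ℕ → Prop} (hP : ∀ q, P q → ¬ P (q + 1)) (N : ℕ) :
    ∀ x a b : ℕ, a + b = N →
      (∀ q, x < q → q < x + (a + 1) + (b + 1) → (P q ↔ q = x + (a + 1))) →
      (peakCount P x (a + b + 3) : ℚ) = 2 ^ (a + b + 1) * ((a + b + 2).choose (a + 1) - 1) := by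
  induction N using Nat.strong_induction_on with
  | _ N ih =>
    intro x a b hN h
    -- For `a = 0` the peak is next to the first entry, which then cannot be the maximum; the
    -- formula agrees because `choose _ 0 - 1 = 0`.
    have t0 : ((if 1 ≤ a + b + 1 → ¬ P (x + 1) then peakCount P (x + 1) (a + b + 2) else 0 : ℕ) : ℚ)
        = 2 ^ (a + b) * ((a + b + 1).choose a - 1) := by
      rcases a with _ | a
      · rw [if_neg]
        · simp
        · simp [(h (x + 1) (by omega) (by omega)).2]
      · rw [if_pos, show a + 1 + b + 2 = a + b + 3 by ring,
          ih (a + b) (by omega) (x + 1) a b rfl]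
        · rw [show a + 1 + b + 1 = a + b + 2 by ring, show a + 1 + b = a + b + 1 by ring]
        · intro q h1 h2
          rw [h q (by omega) (by omega)]; omega
        · intro _
          rw [h (x + 1) (by omega) (by omega)]; omega
    have t1 : ((if 1 ≤ a + b + 1 → ¬ P (x + (a + b + 1)) then peakCount P x (a + b + 2) else 0 : ℕ)
        : ℚ) = 2 ^ (a + b) * ((a + b + 1).choose (a + 1) - 1) := by
      rcases b with _ | b
      · rw [if_neg]
        · simp
        · rw [h _ (by omega) (by omega)]; simp
      · rw [if_pos, show a + (b + 1) + 2 = a + b + 3 by ring, ih (a + b) (by omega) x a b rfl]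
        · rw [show a + (b + 1) + 1 = a + b + 2 by ring, show a + (b + 1) = a + b + 1 by ring]
        · intro q h1 h2
          rw [h q (by omega) (by omega)]
        · intro _
          rw [h _ (by omega) (by omega)]; omega
    rw [show a + b + 3 = (a + b + 1) + 2 by ring, peakCount_add_two hP,
      Finset.sum_eq_single a, if_pos (c := P (x + a + 1))]
    · rw [Nat.cast_add, Nat.cast_add, t0, t1]
      push_cast
      rw [show a + b + 1 - a = b + 1 by omega, peakCount_no_peak hP, peakCount_no_peak hP,
        show a + b + 1 + 1 = a + b + 2 by ring, Nat.choose_succ_succ (a + b + 1) a]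
      · push_cast
        ring
      · intro q h1 h2
        rw [h _ (by omega) (by omega)]; omega
      · intro q h1 h2
        rw [h _ (by omega) (by omega)]; omega
    · rw [h _ (by omega) (by omega), add_assoc]
    · intro k hk hka
      rw [Finset.mem_range] at hk
      rw [if_neg]
      rw [h _ (by omega) (by omega)]; omega
    · intro hk
      simp at hk

theorem sum_range_ite_two {β : Type*} [AddCommMonoid β] {n u v : ℕ} (p : ℕ → Prop)
    [DecidablePred p] (f : ℕ → β) (huv : u ≠ v) (hu : u < n) (hv : v < n)
    (h : ∀ k < n, p k ↔ k = u ∨ k = v) :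
    (∑ k ∈ Finset.range n, if p k then f k else 0) = f u + f v := by
  rw [← Finset.sum_filter, show (Finset.range n).filter p = {u, v} by
    ext k; simp only [Finset.mem_filter, Finset.mem_range, Finset.mem_insert,
      Finset.mem_singleton]
    constructor
    · exact fun hk => (h k hk.1).1 hk.2
    · rintro (rfl | rfl)
      · exact ⟨hu, (h _ hu).2 (Or.inl rfl)⟩
      · exact ⟨hv, (h _ hv).2 (Or.inr rfl)⟩, Finset.sum_pair huv]

theorem choose_mul_shift (s i : ℕ) :
    ((s + i + 1).choose (i + 1) : ℚ) * (i + 1) = (s + i + 1).choose i * (s + 1) := by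
  have := Nat.choose_succ_right_eq (s + i + 1) i
  rw [show s + i + 1 - i = s + 1 by omega] at this
  exact_mod_cast this

-- The second peak is next to the last entry, so the maximum is first or at one of the two peaks.
-- The first case lowers `i` by one, which drives the induction; for `i = 0` it is excluded as well.
-- A maximum at a peak leaves pieces with at most one peak.
open Classical in
theorem peakCount_two_peaks_right {P : ℕ → Prop} (hP : ∀ q, P q → ¬ P (q + 1)) (j i : ℕ) :
    ∀ x : ℕ, (∀ q, x < q → q < x + i + j + 4 → (P q ↔ q = x + i + 1 ∨ q = x + i + j + 3)) →
      (peakCount P x (i + j + 5) : ℚ) = 2 ^ (i + j + 2) * ((j + 1) * (i + j + 3).choose i +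
        (j + 2) * (i + j + 3).choose (i + 1) - (i + j + 3)) := by
  induction i with
  | zero =>
    intro x h
    rw [show 0 + j + 5 = (j + 3) + 2 by ring, peakCount_add_two hP,
      sum_range_ite_two (u := 0) (v := j + 2) _ _ (by omega) (by omega) (by omega), if_neg, if_neg]
    · have e1 : (peakCount P (x + 0 + 2) (j + 3 - 0) : ℚ) =
          2 ^ (j + 1) * ((j + 2).choose (j + 1) - 1) := by
        have := peakCount_one_peak hP j (x + 2) j 0 (by simp) (by
          intro q h1 h2
          rw [h _ (by omega) (by omega)]; omega)
        simpa using this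
      have e2 : (peakCount P x (j + 2 + 1) : ℚ) = 2 ^ (j + 1) * ((j + 2).choose 1 - 1) := by
        have := peakCount_one_peak hP j x 0 j (by simp) (by
          intro q h1 h2
          rw [h _ (by omega) (by omega)]; omega)
        simpa using this
      have e3 : peakCount P x (0 + 1) = 1 := peakCount_no_peak hP 0 x (by intros; omega)
      have e4 : peakCount P (x + (j + 2) + 2) (j + 3 - (j + 2)) = 1 := by
        rw [show j + 3 - (j + 2) = 0 + 1 by omega]
        exact peakCount_no_peak hP 0 _ (by intros; omega)
      simp only [Nat.cast_add, Nat.cast_mul]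
      rw [e1, e2, e3, e4, show j + 3 + 1 = j + 2 + 1 + 1 by ring, Nat.choose_succ_self_right]
      simp
      ring
    · simp [h (x + (j + 3)) (by omega) (by omega)]; omega
    · simp [h (x + 1) (by omega) (by omega)]
    · intro k hk
      rw [h _ (by omega) (by omega)]; omega
  | succ i ih =>
    intro x h
    have t0 : (peakCount P (x + 1) (i + 1 + j + 3 + 1) : ℚ) = 2 ^ (i + j + 2) *
        ((j + 1) * (i + j + 3).choose i + (j + 2) * (i + j + 3).choose (i + 1) - (i + j + 3)) := by
      have := ih (x + 1) (by
        intro q h1 h2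
        rw [h _ (by omega) (by omega)]; omega)
      rw [show i + 1 + j + 3 + 1 = i + j + 5 by ring]
      exact this
    rw [show i + 1 + j + 5 = (i + 1 + j + 3) + 2 by ring, peakCount_add_two hP,
      sum_range_ite_two (u := i + 1) (v := i + j + 3) _ _ (by omega) (by omega) (by omega),
      if_pos, if_neg]
    · have e1 : (peakCount P (x + (i + 1) + 2) (i + 1 + j + 3 - (i + 1)) : ℚ) =
          2 ^ (j + 1) * ((j + 2).choose (j + 1) - 1) := by
        have := peakCount_one_peak hP j (x + (i + 1) + 2) j 0 (by simp) (by
          intro q h1 h2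
          rw [h _ (by omega) (by omega)]; omega)
        rw [show i + 1 + j + 3 - (i + 1) = j + 0 + 3 by omega]
        exact this
      have e2 : (peakCount P x (i + j + 3 + 1) : ℚ) =
          2 ^ (i + j + 2) * ((i + j + 3).choose (i + 2) - 1) := by
        have := peakCount_one_peak hP (i + 1 + j) x (i + 1) j (by simp) (by
          intro q h1 h2
          rw [h _ (by omega) (by omega)]; omega)
        rw [show i + j + 3 + 1 = i + 1 + j + 3 by ring, this,
          show i + 1 + j + 1 = i + j + 2 by ring, show i + 1 + j + 2 = i + j + 3 by ring]
      have e3 : peakCount P x (i + 1 + 1) = 2 ^ (i + 1) := peakCount_no_peak hP _ x (by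
        intro q h1 h2
        rw [h _ (by omega) (by omega)]; omega)
      have e4 : peakCount P (x + (i + j + 3) + 2) (i + 1 + j + 3 - (i + j + 3)) = 1 := by
        rw [show i + 1 + j + 3 - (i + j + 3) = 0 + 1 by omega]
        exact peakCount_no_peak hP 0 _ (by intros; omega)
      simp only [Nat.cast_add, Nat.cast_mul]
      rw [t0, e1, e2, e3, e4, show i + 1 + j + 3 + 1 = (i + j + 3 + 1) + 1 by ring,
        show i + j + 3 + 1 + 1 = (i + j + 3 + 1) + 1 by ring, Nat.choose_succ_self_right,
        show i + 1 + j + 3 = i + j + 3 + 1 by ring, show i + 1 + j + 2 = i + j + 3 by ring,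
        show i + 1 + 1 = i + 2 by ring, show j + 0 + 2 = j + 1 + 1 by ring,
        Nat.choose_succ_self_right]
      -- Pascal's rule alone does not close the identity: the coefficients at `i + 1` and `i + 2`
      -- also have to be compared.
      have r := choose_mul_shift (j + 1) (i + 1)
      rw [show j + 1 + (i + 1) + 1 = i + j + 3 by ring, show i + 1 + 1 = i + 2 by ring] at r
      simp only [Nat.choose_succ_succ (i + j + 3 + 1), Nat.choose_succ_succ (i + j + 3)]
      push_cast at r ⊢
      generalize ((i + j + 3).choose i : ℚ) = A at *
      generalize ((i + j + 3).choose (i + 1) : ℚ) = B at *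
      generalize ((i + j + 3).choose (i + 2) : ℚ) = C at *
      linear_combination (2 : ℚ) ^ (i + j + 2) * r
    · simp [h (x + (i + 1 + j + 3)) (by omega) (by omega)]; omega
    · rw [h _ (by omega) (by omega)]; omega
    · intro k hk
      rw [h _ (by omega) (by omega)]; omega

-- Reversing the positions exchanges the two pieces beside the maximum and preserves the recursion.
-- This transfers the two-peak count to the mirrored pattern.
open Classical in
theorem peakCount_reflect {P P' : ℕ → Prop} (n : ℕ) : ∀ a a' : ℕ,
    (∀ q q', q + q' + 1 = n → 1 ≤ q → 1 ≤ q' → (P (a + q) ↔ P' (a' + q'))) →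
      peakCount P a n = peakCount P' a' n := by
  induction n using Nat.strong_induction_on with
  | _ n ih =>
    intro a a' h
    rcases n with _ | n
    · rw [peakCount_zero, peakCount_zero]
    rw [peakCount_succ, peakCount_succ, ← Finset.sum_range_reflect]
    refine Finset.sum_congr rfl fun k hk => ?_
    rw [Finset.mem_range] at hk
    obtain ⟨r, rfl⟩ : ∃ r, n = k + r := ⟨n - k, by omega⟩
    rw [show k + r + 1 - 1 - k = r by omega, show k + r - r = k by omega,
      show k + r - k = r by omega, Nat.choose_symm_add, ih k (by omega) (a + r + 1) a',
      ih r (by omega) a (a' + k + 1), mul_comm (peakCount P' a' k)]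
    · refine if_congr ?_ rfl rfl
      unfold MaxAllowed
      refine and_congr ?_ ((and_congr ?_ ?_).trans and_comm)
      · constructor
        · intro H h1 h2; exact (h r k (by omega) (by omega) (by omega)).1 (H (by omega) (by omega))
        · intro H h1 h2; exact (h r k (by omega) (by omega) (by omega)).2 (H (by omega) (by omega))
      · have : 2 ≤ r → (P (a + r - 1) ↔ P' (a' + k + 1)) := fun hr => by
          have := h (r - 1) (k + 1) (by omega) (by omega) (by omega)
          rwa [show a + (r - 1) = a + r - 1 by omega] at this
        constructor
        · intro H h1; rw [← this (by omega)]; exact H (by omega)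
        · intro H h1; rw [this (by omega)]; exact H (by omega)
      · have : 2 ≤ k → (P (a + r + 1) ↔ P' (a' + k - 1)) := fun hr => by
          have := h (r + 1) (k - 1) (by omega) (by omega) (by omega)
          rwa [show a' + (k - 1) = a' + k - 1 by omega] at this
        constructor
        · intro H h1; rw [← this (by omega)]; exact H (by omega)
        · intro H h1; rw [this (by omega)]; exact H (by omega)
    · intro q q' h1 h2 h3
      have := h q (q' + k + 1) (by omega) (by omega) (by omega)
      rwa [show a' + (q' + k + 1) = a' + k + 1 + q' by ring] at this
    · intro q q' h1 h2 h3
      have := h (r + q + 1) q' (by omega) (by omega) (by omega)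
      rwa [show a + (r + q + 1) = a + r + 1 + q by ring] at this

theorem peakCount_two_peaks_left {P : ℕ → Prop} (x i j : ℕ)
    (h : ∀ q, x < q → q < x + i + j + 4 → (P q ↔ q = x + 1 ∨ q = x + j + 3)) :
    (peakCount P x (i + j + 5) : ℚ) = 2 ^ (i + j + 2) * ((j + 1) * (i + j + 3).choose i +
        (j + 2) * (i + j + 3).choose (i + 1) - (i + j + 3)) := by
  rw [peakCount_reflect (P' := fun q => q = 0 + i + 1 ∨ q = 0 + i + j + 3) _ x 0]
  · exact peakCount_two_peaks_right (by intro q; omega) j i 0 (fun q _ _ => Iff.rfl)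
  · intro q q' h1 h2 h3
    rw [h _ (by omega) (by omega)]; omega

-- The outer peaks are next to the two ends, so the maximum must be at a peak. At an outer peak it
-- leaves a single entry and a two-peak piece; at the middle peak it leaves two one-peak pieces.
open Classical in
theorem peakCount_three_peaks (i j : ℕ) :
    (peakCount (fun q => q = 1 ∨ q = i + 3 ∨ q = i + j + 5) 0 (i + j + 7) : ℚ) =
      2 ^ (i + j + 2) * ((i + j + 6) * (
        (j + 1) * (i + j + 3).choose i + (j + 2) * (i + j + 3).choose (i + 1)
        + (i + 2) * (i + j + 3).choose (i + 2) + (i + 1) * (i + j + 3).choose (i + 3)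
        - 2 * (i + j + 3)) + (i + 1) * (j + 1) * (i + j + 6).choose (i + 3)) := by
  generalize hPdef : (fun q => q = 1 ∨ q = i + 3 ∨ q = i + j + 5) = P
  replace hPdef : ∀ q, P q ↔ q = 1 ∨ q = i + 3 ∨ q = i + j + 5 := fun q => by rw [← hPdef]
  have hP : ∀ q, P q → ¬ P (q + 1) := by intro q; simp only [hPdef]; omega
  have e1 : (peakCount P 2 (i + j + 5) : ℚ) = _ :=
    peakCount_two_peaks_right hP j i 2 (by intro q _ _; simp only [hPdef]; omega)
  have e2 : (peakCount P 0 (j + i + 5) : ℚ) = _ :=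
    peakCount_two_peaks_left 0 j i (by intro q _ _; simp only [hPdef]; omega)
  have e3 : (peakCount P 0 (0 + i + 3) : ℚ) = _ :=
    peakCount_one_peak hP i 0 0 i (by simp) (by intro q _ _; simp only [hPdef]; omega)
  have e4 : (peakCount P (i + 4) (j + 0 + 3) : ℚ) = _ :=
    peakCount_one_peak hP j (i + 4) j 0 (by simp) (by intro q _ _; simp only [hPdef]; omega)
  have e5 : ∀ x, peakCount P x 1 = 1 := fun x => peakCount_no_peak hP 0 x (by intros; omega)
  have hf : (Finset.range (i + j + 5)).filter (fun k => P (0 + k + 1)) =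
      {0, i + 2, i + j + 4} := by
    ext k
    simp only [hPdef, Finset.mem_filter, Finset.mem_range, Finset.mem_insert,
      Finset.mem_singleton]
    omega
  rw [show i + j + 7 = (i + j + 5) + 2 by ring, peakCount_add_two hP, if_neg, if_neg,
    ← Finset.sum_filter, hf, Finset.sum_insert, Finset.sum_pair]
  · rw [show j + i + 5 = i + j + 4 + 1 by ring, show j + i + 3 = i + j + 3 by ring] at e2
    rw [show 0 + i + 3 = i + 2 + 1 by ring] at e3
    rw [show 0 + 0 + 2 = 2 by rfl, show i + j + 5 - 0 = i + j + 5 by rfl,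
      show 0 + (i + 2) + 2 = i + 4 by ring, show i + j + 5 - (i + 2) = j + 0 + 3 by omega,
      show i + j + 5 - (i + j + 4) = 1 by omega]
    simp only [Nat.cast_add, Nat.cast_mul]
    rw [e1, e2, e3, e4, e5, e5, show i + j + 5 + 1 = (i + j + 4 + 1) + 1 by ring,
      Nat.choose_succ_self_right, zero_add, Nat.choose_one_right,
      Nat.choose_succ_self_right, Nat.choose_one_right,
      show i + j + 4 + 1 + 1 = i + j + 6 by ring, show i + 2 + 1 = i + 3 by ring,
      show (i + j + 3).choose j = (i + j + 3).choose (i + 3) by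
        rw [← Nat.choose_symm_of_eq_add]; ring,
      show (i + j + 3).choose (j + 1) = (i + j + 3).choose (i + 2) by
        rw [← Nat.choose_symm_of_eq_add]; ring]
    push_cast
    ring
  · omega
  · simp
  · simp only [hPdef]; simp
  · simp only [hPdef]; simp

/-- The number of permutations of `i + j + 7` numbers whose peaks are exactly at the positions
`1`, `i + 3` and `i + j + 5`, counted from `0`. -/
theorem card_perm_three_peaks (i j n : ℕ) (hn : n = i + j + 7) [DecidablePred fun σ :
    Equiv.Perm (Fin n) => HasPeaks (fun q => q = 1 ∨ q = i + 3 ∨ q = i + j + 5) 0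
      (List.ofFn fun a => (σ a : ℕ))] :
    ((Finset.univ.filter fun σ : Equiv.Perm (Fin n) =>
      HasPeaks (fun q => q = 1 ∨ q = i + 3 ∨ q = i + j + 5) 0
        (List.ofFn fun a => (σ a : ℕ))).card : ℚ) =
      2 ^ (i + j + 2) * ((i + j + 6) * (
        (j + 1) * (i + j + 3).choose i + (j + 2) * (i + j + 3).choose (i + 1)
        + (i + 2) * (i + j + 3).choose (i + 2) + (i + 1) * (i + j + 3).choose (i + 3)
        - 2 * (i + j + 3)) + (i + 1) * (j + 1) * (i + j + 6).choose (i + 3)) := by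
  classical
  rw [← peakCount_three_peaks, ← hn, ← card_arrangements_hasPeaks _ n 0 (Finset.range n) (by simp)]
  congr 1
  refine Finset.card_bij (fun σ _ => List.ofFn fun a => (σ a : ℕ)) ?_ ?_ ?_
  · intro σ hσ
    refine Finset.mem_filter.2 ⟨mem_arrangements.2 ⟨?_, ?_⟩, (Finset.mem_filter.1 hσ).2⟩
    · exact List.nodup_ofFn.2 (Fin.val_injective.comp σ.injective)
    · ext x
      simp only [List.mem_toFinset, List.mem_ofFn, Finset.mem_range]
      constructor
      · rintro ⟨a, rfl⟩; exact (σ a).2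
      · intro hx; exact ⟨σ.symm ⟨x, hx⟩, by simp⟩
  · intro σ _ τ _ h
    ext a
    exact congrFun (List.ofFn_injective h) a
  · intro l hl
    obtain ⟨hl, hp⟩ := Finset.mem_filter.1 hl
    have hlen := length_of_mem_arrangements hl
    rw [Finset.card_range] at hlen
    obtain ⟨d, f⟩ := mem_arrangements.1 hl
    subst hlen
    have hlt : ∀ a : Fin l.length, l[a] < l.length := fun a => by
      rw [← Finset.mem_range, ← f, List.mem_toFinset]; exact List.getElem_mem _
    have hinj : Function.Injective fun a : Fin l.length => (⟨l[a], hlt a⟩ : Fin l.length) := by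
      intro a b hab
      exact d.injective_get (Fin.mk.inj_iff.1 hab)
    refine ⟨Equiv.ofBijective _ (Finite.injective_iff_bijective.1 hinj), ?_, ?_⟩
    · rw [Finset.mem_filter]
      refine ⟨Finset.mem_univ _, ?_⟩
      simpa using hp
    · simp

/-! ### Deterministic evolution: craters and last hits -/

namespace Meteor

/-- The time of the last jump up to time `t` of a nondecreasing right-continuous path `f`, and `0`
if there is none; defined as a countable infimum in order to be measurable. -/
noncomputable def lastHit (t : ℝ≥0) (f : ℝ≥0 → ℕ) : ℝ≥0 :=
  ⨅ n : ℕ, if f (TopologicalSpace.denseSeq ℝ≥0 n) = f t ∧ TopologicalSpace.denseSeq ℝ≥0 n ≤ t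
    then TopologicalSpace.denseSeq ℝ≥0 n else t

/-- A nondecreasing right-continuous counting path. -/
structure IsCountingPath (f : ℝ≥0 → ℕ) : Prop where
  monotone : Monotone f
  rightContinuous : ∀ t, ContinuousWithinAt f (Set.Ici t) t

theorem lastHit_le_time (t : ℝ≥0) (f : ℝ≥0 → ℕ) : lastHit t f ≤ t := by
  refine (ciInf_le (OrderBot.bddBelow _) 0).trans ?_
  split_ifs with h
  · exact h.2
  · exact le_rfl

/-- If `f s < f t`, right-continuity keeps `f` at `f s` on some `[s, u)`, so no dense point before
`min u t` competes in the infimum. If `f s = f t`, dense points just after `s` do compete. -/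
theorem IsCountingPath.lastHit_le_iff {f : ℝ≥0 → ℕ} (hf : IsCountingPath f) {s t : ℝ≥0}
    (hst : s ≤ t) : lastHit t f ≤ s ↔ f s = f t := by
  constructor
  · intro hL
    by_contra hne
    have hlt : f s < f t := lt_of_le_of_ne (hf.monotone hst) hne
    have hs : s < t := lt_of_le_of_ne hst (by rintro rfl; exact hne rfl)
    have hev : ∀ᶠ u in 𝓝[≥] s, f u = f s := by
      have := (hf.rightContinuous s).eventually
        (discreteTopology_iff_singleton_mem_nhds.1 inferInstance (f s))
      exact this
    obtain ⟨u, hu, hu'⟩ := (mem_nhdsGE_iff_exists_Ico_subset' hs).1 hev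
    have : min u t ≤ lastHit t f := by
      refine le_ciInf fun n => ?_
      split_ifs with h
      · refine (min_le_left _ _).trans ?_
        by_contra hlt'
        push Not at hlt'
        rcases le_or_gt s (TopologicalSpace.denseSeq ℝ≥0 n) with h1 | h1
        · have := hu' ⟨h1, hlt'⟩
          simp only [Set.mem_ofPred_eq] at this
          omega
        · have := hf.monotone h1.le
          omega
      · exact min_le_right _ _
    exact absurd (this.trans hL) (not_le.2 (lt_min hu hs))
  · intro h
    rcases hst.eq_or_lt with rfl | hs
    · exact lastHit_le_time _ _
    by_contra hlt
    push Not at hlt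
    obtain ⟨q, ⟨n, rfl⟩, h1, h2⟩ :=
      (TopologicalSpace.denseRange_denseSeq ℝ≥0).exists_between (lt_min hlt hs)
    refine absurd (ciInf_le (OrderBot.bddBelow _) n : lastHit t f ≤ _) ?_
    rw [if_pos]
    · exact not_le.2 (h2.trans_le (min_le_left _ _))
    · have h3 := (h2.trans_le (min_le_right _ _)).le
      exact ⟨le_antisymm (hf.monotone h3) (h ▸ hf.monotone h1.le), h3⟩

theorem IsCountingPath.lt_lastHit_iff {f : ℝ≥0 → ℕ} (hf : IsCountingPath f) {s t : ℝ≥0}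
    (hst : s ≤ t) : s < lastHit t f ↔ f s < f t := by
  rw [← not_le, hf.lastHit_le_iff hst, (hf.monotone hst).lt_iff_ne]

variable {V : Type*} [Fintype V] {G : SimpleGraph V}

open Classical in
/-- The masses after the vertices in `J` are hit simultaneously. -/
noncomputable def hitMass (G : SimpleGraph V) (J : Set V) (μ : V → ℝ) (v : V) : ℝ :=
  (if v ∈ J then 0 else μ v) + ∑ x : V, if G.Adj v x ∧ x ∈ J then μ x / (G.degree x : ℝ) else 0

theorem hitMass_nonneg {μ : V → ℝ} (hμ : ∀ v, 0 ≤ μ v) (J : Set V) (v : V) :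
    0 ≤ hitMass G J μ v := by
  refine add_nonneg ?_ (Finset.sum_nonneg fun x _ => ?_)
  · split_ifs; exacts [le_rfl, hμ v]
  · split_ifs; exacts [div_nonneg (hμ x) (Nat.cast_nonneg _), le_rfl]

open Classical in
theorem div_degree_le_hitMass {μ : V → ℝ} (hμ : ∀ v, 0 ≤ μ v) {J : Set V} {v w : V}
    (h : G.Adj v w) (hw : w ∈ J) :
    (if v ∈ J then 0 else μ v) + μ w / G.degree w ≤ hitMass G J μ v := by
  refine add_le_add le_rfl ?_
  refine le_trans ?_ (Finset.single_le_sum (fun x _ => ?_) (Finset.mem_univ w))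
  · rw [if_pos ⟨h, hw⟩]
  · split_ifs; exacts [div_nonneg (hμ x) (Nat.cast_nonneg _), le_rfl]

theorem le_hitMass {μ : V → ℝ} (hμ : ∀ v, 0 ≤ μ v) {J : Set V} {v : V} (h : v ∉ J) :
    μ v ≤ hitMass G J μ v := by
  unfold hitMass
  rw [if_neg h]
  refine le_add_of_nonneg_right (Finset.sum_nonneg fun x _ => ?_)
  split_ifs; exacts [div_nonneg (hμ x) (Nat.cast_nonneg _), le_rfl]

open Classical in
theorem degree_pos_of_adj {v w : V} (h : G.Adj v w) : (0 : ℝ) < G.degree w :=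
  Nat.cast_pos.2 ((G.degree_pos_iff_exists_adj w).2 ⟨v, h.symm⟩)

open Classical in
theorem hitMass_pos {μ : V → ℝ} (hμ : ∀ v, 0 ≤ μ v) {J : Set V} {v w : V}
    (h : G.Adj v w) (hpos : 0 < μ v + μ w) (hv : v ∉ J) (hw : w ∈ J) : 0 < hitMass G J μ v := by
  have h1 := div_degree_le_hitMass hμ h hw
  rw [if_neg hv] at h1
  have h2 := degree_pos_of_adj h
  refine lt_of_lt_of_le ?_ h1
  rcases (hμ v).eq_or_lt with h0 | h0
  · rw [← h0, zero_add] at hpos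
    have := div_pos hpos h2
    linarith
  · have := div_nonneg (hμ w) h2.le
    linarith

/-- All masses are nonnegative and the endpoints `v`, `w` of an edge are not both empty. -/
def EdgePos (v w : V) (μ : V → ℝ) : Prop := (∀ x, 0 ≤ μ x) ∧ 0 < μ v + μ w

-- If one endpoint is hit, the other keeps its mass and gains a share; if both are hit, they
-- exchange shares; if neither is, both keep their mass. Some mass survives on the edge in every
-- case.
open Classical in
theorem EdgePos.hitMass {μ : V → ℝ} {v w : V} (h : G.Adj v w) (hμ : EdgePos v w μ) (J : Set V) :
    EdgePos v w (hitMass G J μ) := by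
  obtain ⟨h0, hpos⟩ := hμ
  refine ⟨hitMass_nonneg h0 J, ?_⟩
  have nv := hitMass_nonneg (G := G) h0 J v
  have nw := hitMass_nonneg (G := G) h0 J w
  by_cases hv : v ∈ J <;> by_cases hw : w ∈ J
  · have h1 := div_degree_le_hitMass h0 h hw
    have h2 := div_degree_le_hitMass h0 h.symm hv
    rw [if_pos hv] at h1
    rw [if_pos hw] at h2
    have dv := degree_pos_of_adj h.symm
    have dw := degree_pos_of_adj h
    rcases (h0 v).eq_or_lt with h3 | h3
    · rw [← h3, zero_add] at hpos
      have := div_pos hpos dw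
      linarith
    · have := div_pos h3 dv
      linarith
  · have := hitMass_pos h0 h.symm (by linarith) hw hv
    linarith
  · have := hitMass_pos h0 h hpos hv hw
    linarith
  · have := le_hitMass (G := G) h0 hv
    have := le_hitMass (G := G) h0 hw
    linarith

variable {N : V → ℝ≥0 → ℕ} {m : ℝ≥0 → V → ℝ}

theorem FollowsHits.eq_of_forall_eq (h : FollowsHits G N m) {s t : ℝ≥0} (hst : s ≤ t)
    (hN : ∀ x, N x s = N x t) : m s = m t :=
  funext fun v => h.1 v s t hst fun x _ => hN x

/-- The number of hits still to come before or at `s` is a natural number; a time minimizing it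
admits no further hit before `s`. This replaces left limits by values at an actual earlier time. -/
theorem exists_last_value_before (hN : ∀ v, IsCountingPath (N v)) {r₀ s : ℝ≥0} (hr : r₀ < s) :
    ∃ r, r₀ ≤ r ∧ r < s ∧ ∀ r', r ≤ r' → r' < s → ∀ x, N x r' = N x r := by
  classical
  have hmono : ∀ {a b : ℝ≥0}, a ≤ b → ∑ x, N x a ≤ ∑ x, N x b := fun hab =>
    Finset.sum_le_sum fun x _ => (hN x).monotone hab
  have hex : ∃ n, ∃ r, r₀ ≤ r ∧ r < s ∧ ∑ x, N x s - ∑ x, N x r = n := ⟨_, r₀, le_rfl, hr, rfl⟩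
  obtain ⟨r, h1, h2, h3⟩ := Nat.find_spec hex
  refine ⟨r, h1, h2, fun r' h4 h5 x => ?_⟩
  have h6 := Nat.find_min' hex ⟨r', h1.trans h4, h5, rfl⟩
  rw [← h3] at h6
  have h7 := hmono h4
  have h8 := hmono h5.le
  have h9 : ∑ x, N x r = ∑ x, N x r' := by omega
  exact ((Finset.sum_eq_sum_iff_of_le fun x _ => (hN x).monotone h4).1 h9 x
    (Finset.mem_univ x)).symm

theorem FollowsHits.exists_before (h : FollowsHits G N m) (hN : ∀ v, IsCountingPath (N v))
    {r₀ s : ℝ≥0} (hr : r₀ < s) :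
    ∃ r, r₀ ≤ r ∧ r < s ∧ m s = hitMass G {x | N x r < N x s} (m r) := by
  have hs : 0 < s := (zero_le (a := r₀)).trans_lt hr
  obtain ⟨r, h1, h2, h3⟩ := exists_last_value_before hN hr
  refine ⟨r, h1, h2, ?_⟩
  obtain ⟨m', hm', hev⟩ := h.2 s hs
  have hne : (𝓝[<] s).NeBot := nhdsLT_neBot_of_exists_lt ⟨0, hs⟩
  obtain rfl : m' = m r := by
    funext v
    refine tendsto_nhds_unique (hm' v) (tendsto_const_nhds.congr' ?_)
    filter_upwards [Ico_mem_nhdsLT h2] with u hu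
    exact congrFun (h.eq_of_forall_eq hu.1 fun x => (h3 u hu.1 hu.2 x).symm) v
  have hJ : ∀ x, JumpsAt (N x) s ↔ x ∈ {x | N x r < N x s} := fun x => by
    refine ⟨fun hx => hx.2 r h2, fun hx => ⟨hs, fun u hu => ?_⟩⟩
    refine lt_of_le_of_lt ((hN x).monotone (le_max_left u r)) ?_
    rw [h3 _ (le_max_right u r) (max_lt hu h2)]
    exact hx
  funext v
  rw [hev v]
  unfold hitMass
  congr! 3
  · exact hJ v
  · exact and_congr_right fun _ => hJ _

/-- Nothing changes after the latest hit `τ` of all vertices, and just before `τ` strictly fewer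
hits have occurred, so the induction runs on the total number of hits. Simultaneous hits are
allowed. -/
theorem FollowsHits.induction (h : FollowsHits G N m) (hN : ∀ v, IsCountingPath (N v))
    {R : (V → ℝ) → Prop} (h0 : R (m 0)) (hstep : ∀ μ J, R μ → R (hitMass G J μ)) (t : ℝ≥0) :
    R (m t) := by
  induction hn : ∑ x, N x t using Nat.strong_induction_on generalizing t with
  | _ n ih =>
    set τ := Finset.univ.sup fun x => lastHit t (N x) with hτ
    have hle : ∀ x, lastHit t (N x) ≤ τ := fun x => Finset.le_sup (f := fun x => lastHit t (N x))
      (Finset.mem_univ x)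
    have hτt : τ ≤ t := Finset.sup_le fun x _ => lastHit_le_time _ _
    have hNτ : ∀ x, N x τ = N x t := fun x => ((hN x).lastHit_le_iff hτt).1 (hle x)
    rw [← h.eq_of_forall_eq hτt hNτ]
    rcases (zero_le (a := τ)).eq_or_lt with h1 | h1
    · rwa [← h1]
    obtain ⟨r, -, hr, hm⟩ := h.exists_before hN h1
    rw [hm]
    refine hstep _ _ (ih _ ?_ r rfl)
    rw [← hn]
    refine lt_of_le_of_ne (Finset.sum_le_sum fun x _ => (hN x).monotone (hr.le.trans hτt)) ?_
    intro heq
    rw [Finset.sum_eq_sum_iff_of_le fun x _ => (hN x).monotone (hr.le.trans hτt)] at heq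
    refine absurd hr (not_lt.2 (Finset.sup_le fun x hx => ?_))
    exact ((hN x).lastHit_le_iff (hr.le.trans hτt)).2 (heq x hx)

theorem FollowsHits.edgePos (h : FollowsHits G N m) (hN : ∀ v, IsCountingPath (N v)) {v w : V}
    (hvw : G.Adj v w) (h0 : EdgePos v w (m 0)) (t : ℝ≥0) : EdgePos v w (m t) :=
  h.induction hN h0 (fun _ J hμ => hμ.hitMass hvw J) t

theorem FollowsHits.eq_zero (h : FollowsHits G N m) (hN : ∀ v, IsCountingPath (N v)) {v : V}
    {t : ℝ≥0} (hpos : 0 < lastHit t (N v))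
    (hlt : ∀ w, G.Adj v w → lastHit t (N w) < lastHit t (N v)) : m t v = 0 := by
  classical
  have hτt := lastHit_le_time t (N v)
  have hx : ∀ x, x = v ∨ G.Adj v x → N x (lastHit t (N v)) = N x t := by
    rintro x (rfl | hx)
    · exact ((hN x).lastHit_le_iff hτt).1 le_rfl
    · exact ((hN x).lastHit_le_iff hτt).1 (hlt x hx).le
  rw [← h.1 v _ t hτt hx]
  -- Starting after the last hits of all neighbors ensures that only `v`, and no neighbor of it, is
  -- hit between `r` and the last hit of `v`. Positivity of the latter covers an empty supremum.
  have hr₀ : (Finset.univ.filter (G.Adj v)).sup (fun w => lastHit t (N w)) < lastHit t (N v) := by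
    rw [Finset.sup_lt_iff hpos]
    intro w hw
    exact hlt w (Finset.mem_filter.1 hw).2
  obtain ⟨r, h1, h2, h3⟩ := h.exists_before hN hr₀
  rw [h3, hitMass, if_pos, Finset.sum_eq_zero, add_zero]
  · intro x _
    rw [if_neg]
    rintro ⟨ha, hb⟩
    have : lastHit t (N x) ≤ r :=
      (Finset.le_sup (f := fun w => lastHit t (N w)) (by simpa using ha)).trans h1
    rw [(hN x).lastHit_le_iff (h2.le.trans hτt)] at this
    have h4 : N x r < N x (lastHit t (N v)) := hb
    rw [this, hx x (Or.inr ha)] at h4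
    exact lt_irrefl _ h4
  · change N v r < N v (lastHit t (N v))
    rw [hx v (Or.inl rfl), ← (hN v).lt_lastHit_iff (h2.le.trans hτt)]
    exact h2

/-- Let `u` be the neighbor of `v` hit last. Just before that hit the edge from `v` to `u` carries
mass, and `v` itself is no longer hit, so the hit leaves mass at `v`. Afterwards neither `v` nor its
neighbors are hit. -/
theorem FollowsHits.pos (h : FollowsHits G N m) (hN : ∀ v, IsCountingPath (N v))
    (h0 : ∀ v w, G.Adj v w → EdgePos v w (m 0)) {v w : V} {t : ℝ≥0} (hvw : G.Adj v w)
    (hlt : lastHit t (N v) < lastHit t (N w)) : 0 < m t v := by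
  classical
  obtain ⟨u, hu, hmax⟩ := Finset.exists_max_image (Finset.univ.filter (G.Adj v))
    (fun w => lastHit t (N w)) ⟨w, by simpa using hvw⟩
  simp only [Finset.mem_filter, Finset.mem_univ, true_and] at hu hmax
  have hlt' := hlt.trans_le (hmax w hvw)
  have hτt := lastHit_le_time t (N u)
  have hx : ∀ x, x = v ∨ G.Adj v x → N x (lastHit t (N u)) = N x t := by
    rintro x (rfl | hx)
    · exact ((hN x).lastHit_le_iff hτt).1 hlt'.le
    · exact ((hN x).lastHit_le_iff hτt).1 (hmax x hx)
  rw [← h.1 v _ t hτt hx]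
  obtain ⟨r, h1, h2, h3⟩ := h.exists_before hN hlt'
  rw [h3]
  have hp := h.edgePos hN hu (h0 v u hu) r
  refine hitMass_pos hp.1 hu hp.2 ?_ ?_
  · change ¬ N v r < N v _
    rw [hx v (Or.inl rfl), ((hN v).lastHit_le_iff (h2.le.trans hτt)).1 h1]
    exact lt_irrefl _
  · change N u r < N u _
    rw [hx u (Or.inr hu), ← (hN u).lt_lastHit_iff (h2.le.trans hτt)]
    exact h2

theorem FollowsHits.eq_hitMass_singleton (h : FollowsHits G N m) (hN : ∀ v, IsCountingPath (N v))
    {u : V} {t : ℝ≥0} (hu : N u t = N u 0 + 1) (hx : ∀ x, x ≠ u → N x t = N x 0) :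
    m t = hitMass G {u} (m 0) := by
  have hτt := lastHit_le_time t (N u)
  have hpos : 0 < lastHit t (N u) := by
    rw [(hN u).lt_lastHit_iff (zero_le (a := t)), hu]; exact Nat.lt_succ_self _
  have huτ : N u (lastHit t (N u)) = N u t := ((hN u).lastHit_le_iff hτt).1 le_rfl
  have hxs : ∀ s, s ≤ t → ∀ x, x ≠ u → N x s = N x 0 := fun s hs x hxu =>
    le_antisymm (((hN x).monotone hs).trans (hx x hxu).le) ((hN x).monotone (zero_le (a := s)))
  rw [← h.eq_of_forall_eq hτt]
  · obtain ⟨r, -, h2, h3⟩ := h.exists_before hN hpos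
    have hr : N u r = N u 0 := by
      have := ((hN u).lt_lastHit_iff (h2.le.trans hτt)).1 h2
      have := (hN u).monotone (zero_le (a := r))
      omega
    rw [h3, ← h.eq_of_forall_eq (zero_le (a := r))]
    · congr 1
      ext x
      by_cases hxu : x = u
      · subst hxu; simp [huτ, hu, hr]
      · simp [hxu, hxs r (h2.le.trans hτt) x hxu, hxs _ hτt x hxu]
    · intro x
      by_cases hxu : x = u
      · subst hxu; exact hr.symm
      · exact (hxs r (h2.le.trans hτt) x hxu).symm
  · intro x
    by_cases hxu : x = u
    · subst hxu; exact huτ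
    · rw [hxs _ hτt x hxu, hx x hxu]

end Meteor

namespace Meteor

/-! ### Consequences of stationarity, and the law of the last hits -/

section Stationary

variable {V : Type*} [Fintype V] {G : SimpleGraph V} {Ω : Type*} [MeasurableSpace Ω]
  {P : Measure Ω} {N : V → ℝ≥0 → Ω → ℕ} {M : ℝ≥0 → Ω → V → ℝ}

theorem IsMeteorProcess.ae_isCountingPath (hM : IsMeteorProcess G P N M) :
    ∀ᵐ ω ∂P, ∀ v, IsCountingPath fun t => N v t ω := by
  rw [ae_all_iff]
  intro v
  filter_upwards [(hM.poisson v).monotone, (hM.poisson v).rightContinuous] with ω h1 h2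
  exact ⟨h1, h2⟩

theorem IsMeteorProcess.measure_single_hit_ne_zero (hM : IsMeteorProcess G P N M) (u : V)
    [DecidableEq V] : P {ω | ∀ v, N v 1 ω - N v 0 ω = if v = u then 1 else 0} ≠ 0 := by
  have hind := hM.indep.comp (fun _ (f : ℝ≥0 → ℕ) => f 1 - f 0) (fun _ => by fun_prop)
  have := iIndepFun_iff_measure_inter_preimage_eq_mul.1 hind Finset.univ
    (sets := fun v => {if v = u then 1 else 0}) (fun _ _ => measurableSet_singleton _)
  have heq : {ω | ∀ v, N v 1 ω - N v 0 ω = if v = u then 1 else 0} = ⋂ v ∈ (Finset.univ : Finset V),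
      ((fun f : ℝ≥0 → ℕ => f 1 - f 0) ∘ fun ω t => N v t ω) ⁻¹' {if v = u then 1 else 0} := by
    ext ω; simp
  rw [heq, this, Finset.prod_ne_zero_iff]
  intro v _
  have hmeas : Measurable fun ω => N v 1 ω - N v 0 ω :=
    ((hM.poisson v).measurable 1).sub ((hM.poisson v).measurable 0)
  have h1 := (hM.poisson v).increment_law 0 1 zero_le_one
  have h2 : P.map (fun ω => N v 1 ω - N v 0 ω) {if v = u then 1 else 0} ≠ 0 := by
    rw [h1, poissonMeasure_singleton]
    simp only [tsub_zero, NNReal.coe_one, one_pow, mul_one, ne_eq, ENNReal.ofReal_eq_zero, not_le]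
    positivity
  rwa [Measure.map_apply hmeas (measurableSet_singleton _)] at h2

theorem measurable_lastHit (t : ℝ≥0) : Measurable (lastHit t) := by
  refine Measurable.iInf fun n => Measurable.ite ?_ measurable_const measurable_const
  refine MeasurableSet.inter (measurableSet_eq_fun (by fun_prop) (by fun_prop)) ?_
  exact MeasurableSet.const _

theorem IsMeteorProcess.measurable_lastHit_comp (hM : IsMeteorProcess G P N M) (t : ℝ≥0) (v : V) :
    Measurable fun ω => lastHit t fun s => N v s ω :=
  (measurable_lastHit t).comp (measurable_pi_lambda _ fun s => (hM.poisson v).measurable s)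

theorem IsMeteorProcess.iIndepFun_lastHit (hM : IsMeteorProcess G P N M) (t : ℝ≥0) :
    iIndepFun (fun v ω => lastHit t fun s => N v s ω) P :=
  hM.indep.comp (fun _ => lastHit t) fun _ => measurable_lastHit t

theorem IsMeteorProcess.measure_lastHit_le (hM : IsMeteorProcess G P N M) {s t : ℝ≥0}
    (hst : s ≤ t) (v : V) :
    P {ω | lastHit t (fun r => N v r ω) ≤ s} = ENNReal.ofReal (Real.exp (s - t)) := by
  have h1 := congrArg (fun Q => Q {0}) ((hM.poisson v).increment_law s t hst)
  have hmeas : Measurable fun ω => N v t ω - N v s ω :=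
    ((hM.poisson v).measurable t).sub ((hM.poisson v).measurable s)
  simp only [Measure.map_apply hmeas (measurableSet_singleton _), poissonMeasure_singleton] at h1
  have h2 : P {ω | lastHit t (fun r => N v r ω) ≤ s} =
      P ((fun ω => N v t ω - N v s ω) ⁻¹' {0}) := by
    refine measure_congr (eventuallyEq_set.2 ?_)
    filter_upwards [hM.ae_isCountingPath] with ω hω
    have h3 := (hω v).monotone hst
    change lastHit t (fun r => N v r ω) ≤ s ↔ N v t ω - N v s ω = 0
    rw [(hω v).lastHit_le_iff hst]
    omega
  rw [h2, h1]
  simp [NNReal.coe_sub hst]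

variable [IsProbabilityMeasure P]

/-- In the stationary regime an occupied vertex is never next to two empty vertices in a row. -/
theorem IsMeteorProcess.ae_not_pos_zero_zero (hM : IsMeteorProcess G P N M)
    (hstat : IsStationaryRegime P M) {u v w : V} (huv : G.Adj v u) (hvw : G.Adj v w) :
    ∀ᵐ ω ∂P, ¬ (0 < M 0 ω u ∧ M 0 ω v = 0 ∧ M 0 ω w = 0) := by
  classical
  set D : Set (V → ℝ) := {μ | μ v = 0 ∧ μ w = 0} with hD
  have hDm : MeasurableSet D :=
    (measurableSet_eq_fun (measurable_pi_apply v) measurable_const).inter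
      (measurableSet_eq_fun (measurable_pi_apply w) measurable_const)
  -- An edge empty at time `1` was already empty at time `0`; since both events have the same
  -- probability, they agree almost surely.
  have hsub : (M 1 ⁻¹' D : Set Ω) ≤ᵐ[P] M 0 ⁻¹' D := by
    filter_upwards [hM.ae_isCountingPath, hM.evolution, hM.initial_nonneg] with ω h1 h2 h3 h4
    by_contra h5
    have h6 : EdgePos v w (M 0 ω) := by
      refine ⟨h3, lt_of_le_of_ne (add_nonneg (h3 v) (h3 w)) fun h7 => h5 ?_⟩
      exact ⟨by linarith [h3 v, h3 w], by linarith [h3 v, h3 w]⟩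
    have h8 := (h2.edgePos h1 hvw h6 1).2
    have h9 : M 1 ω v = 0 ∧ M 1 ω w = 0 := h4
    simp only [h9.1, h9.2] at h8
    linarith
  have hae : (M 1 ⁻¹' D : Set Ω) =ᵐ[P] M 0 ⁻¹' D :=
    ae_eq_of_ae_subset_of_measure_ge hsub ((hstat 1).measure_mem_eq hDm).ge
      ((hM.measurable_mass 1) hDm).nullMeasurableSet (measure_ne_top _ _)
  set S : Set (V → ℝ) := {μ | 0 < μ u ∧ μ v = 0 ∧ μ w = 0} with hS
  have hSm : MeasurableSet S :=
    (measurableSet_lt measurable_const (measurable_pi_apply u)).inter hDm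
  set T : Set (V → ℝ≥0 → ℕ) := {f | ∀ x, f x 1 - f x 0 = if x = u then 1 else 0} with hT
  have hTm : MeasurableSet T := by
    rw [hT, Set.ofPred_forall]
    refine MeasurableSet.iInter fun x => measurableSet_eq_fun ?_ measurable_const
    fun_prop
  have hprod := hM.indep_initial.measure_inter_preimage_eq_mul S T hSm hTm
  -- If only `u` is hit, and exactly once, then `v` receives mass by time `1`, contradicting the
  -- persistence of emptiness.
  have hnull : P (M 0 ⁻¹' S ∩ (fun ω x t => N x t ω) ⁻¹' T) = 0 := by
    refine measure_eq_zero_iff_ae_notMem.2 ?_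
    filter_upwards [hM.ae_isCountingPath, hM.evolution, hM.initial_nonneg, hae.mem_iff]
      with ω h1 h2 h3 h4 h5
    obtain ⟨⟨h6, h7⟩, h8⟩ := h5
    have h9 := (h4.2 h7).1
    have hN : ∀ x, N x 1 ω - N x 0 ω = if x = u then 1 else 0 := h8
    have hmon : ∀ x, N x 0 ω ≤ N x 1 ω := fun x => (h1 x).monotone zero_le_one
    have h10 := h2.eq_hitMass_singleton h1 (u := u) (t := 1)
      (by have := hN u; rw [if_pos rfl] at this; have := hmon u; omega)
      (fun x hx => by have := hN x; rw [if_neg hx] at this; have := hmon x; omega)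
    have h11 : 0 < M 1 ω v := by
      rw [h10]
      exact hitMass_pos h3 huv (by linarith [h3 v]) (by simpa using huv.ne) (Set.mem_singleton u)
    exact h11.ne' h9
  rw [hprod, mul_eq_zero] at hnull
  refine measure_eq_zero_iff_ae_notMem.1 (hnull.resolve_right ?_)
  exact hM.measure_single_hit_ne_zero u

theorem IsMeteorProcess.map_lastHit_eq (hM : IsMeteorProcess G P N M) (t : ℝ≥0) (v w : V) :
    P.map (fun ω => lastHit t fun s => N v s ω) = P.map (fun ω => lastHit t fun s => N w s ω) := by
  have := Measure.isProbabilityMeasure_map (μ := P) (hM.measurable_lastHit_comp t v).aemeasurable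
  refine Measure.ext_of_Iic _ _ fun s => ?_
  rw [Measure.map_apply (hM.measurable_lastHit_comp t v) measurableSet_Iic,
    Measure.map_apply (hM.measurable_lastHit_comp t w) measurableSet_Iic]
  rcases le_total s t with h | h
  · exact (hM.measure_lastHit_le h v).trans (hM.measure_lastHit_le h w).symm
  · congr 1
    ext ω
    simp [(lastHit_le_time t _).trans h]

/-- The only atom is at `0`, the value when there is no hit, and has mass `exp (-t)`. At other
points the distribution function is continuous or the event is empty. -/
theorem IsMeteorProcess.measure_lastHit_eq_le (hM : IsMeteorProcess G P N M) (t s : ℝ≥0) (v : V) :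
    P {ω | lastHit t (fun r => N v r ω) = s} ≤ ENNReal.ofReal (Real.exp (-t)) := by
  rcases lt_or_ge t s with h | h
  · refine le_of_eq_of_le (measure_mono_null (fun ω hω => ?_) (measure_empty (μ := P))) zero_le
    exact absurd (lastHit_le_time t fun r => N v r ω) (not_le.2 (h.trans_eq (Eq.symm hω)))
  rcases (zero_le (a := s)).eq_or_lt with rfl | h0
  · refine (measure_mono (t := {ω | lastHit t (fun r => N v r ω) ≤ 0}) fun ω hω =>
      Eq.le hω).trans ?_
    rw [hM.measure_lastHit_le h]
    simp
  · have hbound : ∀ r, r < s → P {ω | lastHit t (fun r => N v r ω) = s} ≤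
        ENNReal.ofReal (Real.exp (s - t) - Real.exp (r - t)) := by
      intro r hr
      rw [ENNReal.ofReal_sub _ (Real.exp_pos _).le, ← hM.measure_lastHit_le h v,
        ← hM.measure_lastHit_le (hr.le.trans h) v, ← measure_sdiff
          (s₁ := {ω | lastHit t (fun r => N v r ω) ≤ s})
          (s₂ := {ω | lastHit t (fun r => N v r ω) ≤ r}) (fun ω hω => le_trans hω hr.le)
          ((hM.measurable_lastHit_comp t v) measurableSet_Iic).nullMeasurableSet
          (measure_ne_top _ _)]
      refine measure_mono fun ω (hω : _ = _) => ?_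
      exact ⟨hω.le, fun h' => absurd (hω ▸ h') (not_le.2 hr)⟩
    have hne : (𝓝[<] s).NeBot := nhdsLT_neBot_of_exists_lt ⟨0, h0⟩
    have htend : Tendsto (fun r : ℝ≥0 => ENNReal.ofReal (Real.exp (s - t) - Real.exp (r - t)))
        (𝓝[<] s) (𝓝 (ENNReal.ofReal (Real.exp (s - t) - Real.exp (s - t)))) := by
      refine Tendsto.mono_left (Continuous.tendsto (ENNReal.continuous_ofReal.comp ?_) s)
        nhdsWithin_le_nhds
      fun_prop
    have := ge_of_tendsto htend (by filter_upwards [self_mem_nhdsWithin] with r hr using hbound r hr)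
    rw [sub_self, ENNReal.ofReal_zero] at this
    exact this.trans zero_le

/-- By independence one time may be fixed, and the bound on the point masses of the other is
integrated. -/
theorem IsMeteorProcess.measure_lastHit_eq_lastHit_le (hM : IsMeteorProcess G P N M) (t : ℝ≥0)
    {v w : V} (hvw : v ≠ w) :
    P {ω | lastHit t (fun s => N v s ω) = lastHit t (fun s => N w s ω)} ≤
      ENNReal.ofReal (Real.exp (-t)) := by
  have mv := hM.measurable_lastHit_comp t v
  have mw := hM.measurable_lastHit_comp t w
  have hind := (indepFun_iff_map_prod_eq_prod_map_map mv.aemeasurable mw.aemeasurable).1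
    ((hM.iIndepFun_lastHit t).indepFun hvw)
  have h1 : P {ω | lastHit t (fun s => N v s ω) = lastHit t (fun s => N w s ω)} =
      P.map (fun ω => (lastHit t (fun s => N v s ω), lastHit t (fun s => N w s ω)))
        (Set.diagonal ℝ≥0) := by
    rw [Measure.map_apply (mv.prodMk mw) measurableSet_diagonal]
    rfl
  have := Measure.isProbabilityMeasure_map (μ := P) mv.aemeasurable
  have := Measure.isProbabilityMeasure_map (μ := P) mw.aemeasurable
  rw [h1, hind, Measure.prod_apply measurableSet_diagonal]
  refine (lintegral_mono (g := fun _ => ENNReal.ofReal (Real.exp (-t))) fun x => ?_).trans ?_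
  · rw [Measure.map_apply mw (measurable_prodMk_left measurableSet_diagonal)]
    refine (measure_mono fun ω hω => ?_).trans (hM.measure_lastHit_eq_le t x w)
    exact Eq.symm hω
  · rw [lintegral_const, measure_univ, mul_one]

end Stationary

/-! ### Equally likely orders of independent identically distributed variables -/

section Exchangeable

variable {n : ℕ} {α : Type*} [LinearOrder α]

/-- The vectors whose entries are increasing in the order given by `σ`. -/
def orderCone (α : Type*) [LinearOrder α] {n : ℕ} (σ : Equiv.Perm (Fin n)) : Set (Fin n → α) :=
  {x | StrictMono (x ∘ σ)}

theorem injective_of_mem_orderCone {σ : Equiv.Perm (Fin n)} {x : Fin n → α}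
    (hx : x ∈ orderCone α σ) : Function.Injective x := by
  have := StrictMono.injective hx
  rwa [Equiv.injective_comp] at this

theorem disjoint_orderCone {σ τ : Equiv.Perm (Fin n)} (h : σ ≠ τ) :
    Disjoint (orderCone α σ) (orderCone α τ) := by
  rw [Set.disjoint_left]
  intro x hσ hτ
  have := (StrictMono.range_inj hσ hτ).1 (by simp [Set.range_comp])
  exact h (Equiv.ext fun a => injective_of_mem_orderCone hσ (congrFun this a))

theorem iUnion_orderCone :
    ⋃ σ : Equiv.Perm (Fin n), orderCone α σ = {x | Function.Injective x} := by
  ext x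
  simp only [Set.mem_iUnion]
  constructor
  · rintro ⟨σ, hσ⟩
    exact injective_of_mem_orderCone hσ
  · intro hx
    exact ⟨Tuple.sort x, (Tuple.monotone_sort x).strictMono_of_injective
      (Function.Injective.comp hx (Tuple.sort x).injective)⟩

variable [TopologicalSpace α] [OrderClosedTopology α]
  [SecondCountableTopology α] [MeasurableSpace α] [BorelSpace α]

theorem measurableSet_orderCone (σ : Equiv.Perm (Fin n)) : MeasurableSet (orderCone α σ) := by
  have : orderCone α σ = ⋂ a, ⋂ b, ⋂ _ : a < b, {x | x (σ a) < x (σ b)} := by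
    ext x
    simp [orderCone, StrictMono]
  rw [this]
  exact MeasurableSet.iInter fun a => MeasurableSet.iInter fun b => MeasurableSet.iInter fun _ =>
    measurableSet_lt (measurable_pi_apply _) (measurable_pi_apply _)

theorem pi_orderCone (ν : Measure α) [IsProbabilityMeasure ν] (σ : Equiv.Perm (Fin n)) :
    Measure.pi (fun _ => ν) (orderCone α σ) =
      Measure.pi (fun _ => ν) (orderCone α (1 : Equiv.Perm (Fin n))) := by
  have h := measurePreserving_piCongrLeft (fun _ : Fin n => ν) σ.symm
  rw [← h.measure_preimage (measurableSet_orderCone 1).nullMeasurableSet]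
  congr 1
  ext x
  have : ∀ a, MeasurableEquiv.piCongrLeft (fun _ => α) σ.symm x a = x (σ a) := fun a => by
    simp [MeasurableEquiv.piCongrLeft, Equiv.piCongrLeft_apply]
  have e : (MeasurableEquiv.piCongrLeft (fun _ => α) σ.symm x) ∘ (1 : Equiv.Perm (Fin n)) =
    x ∘ σ := funext this
  change StrictMono _ ↔ StrictMono _
  rw [e]

/-- For independent identically distributed entries all orders are equally likely. -/
theorem factorial_mul_pi_orderCones (ν : Measure α) [IsProbabilityMeasure ν]
    (s : Finset (Equiv.Perm (Fin n))) :
    (n.factorial : ℝ) * (Measure.pi fun _ => ν).real (⋃ σ ∈ s, orderCone α σ) =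
      s.card * (Measure.pi fun _ => ν).real {x : Fin n → α | Function.Injective x} := by
  have key : ∀ s : Finset (Equiv.Perm (Fin n)), (Measure.pi fun _ => ν).real
      (⋃ σ ∈ s, orderCone α σ) =
        s.card * (Measure.pi fun _ => ν).real (orderCone α (1 : Equiv.Perm (Fin n))) := by
    intro s
    rw [measureReal_biUnion_finset (fun σ _ τ _ h => disjoint_orderCone h)
      (fun σ _ => measurableSet_orderCone σ), Finset.sum_congr rfl fun σ _ => by
        rw [measureReal_def, pi_orderCone, ← measureReal_def]]
    simp
  have huniv := key Finset.univ
  simp only [Finset.mem_univ, Set.iUnion_true, iUnion_orderCone, Finset.card_univ,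
    Fintype.card_perm, Fintype.card_fin] at huniv
  rw [key, huniv]
  ring

end Exchangeable

end Meteor

namespace Meteor

/-! ### The cycle: craters as peaks of the last hits -/

section Cycle

variable {k : ℕ} [NeZero k]

theorem site_inj_of_le {a b : ℕ} (ha : 1 ≤ a) (hb : 1 ≤ b) (hak : a ≤ k) (hbk : b ≤ k)
    (h : site k a = site k b) : a = b := by
  have h' : a % k = b % k := congrArg Fin.val h
  rcases hak.eq_or_lt with rfl | h1 <;> rcases hbk.eq_or_lt with h2 | h2
  · exact h2.symm
  · rw [Nat.mod_self, Nat.mod_eq_of_lt h2] at h'; omega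
  · rw [h2, Nat.mod_self, Nat.mod_eq_of_lt h1] at h'; omega
  · rwa [Nat.mod_eq_of_lt h1, Nat.mod_eq_of_lt h2] at h'

theorem site_val (v : Fin k) : site k v = v :=
  Fin.ext (Nat.mod_eq_of_lt v.2)

theorem cycleGraph_adj_site_iff (hk : 2 ≤ k) (n : ℕ) (w : Fin k) :
    (SimpleGraph.cycleGraph k).Adj (site k (n + 1)) w ↔ w = site k n ∨ w = site k (n + 2) := by
  obtain ⟨k, rfl⟩ : ∃ k', k = k' + 2 := ⟨k - 2, by omega⟩
  have h : ∀ n, site (k + 2) (n + 1) = site (k + 2) n + 1 := fun n => by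
    ext; simp [site, Fin.val_add]
  rw [SimpleGraph.cycleGraph_adj, h (n + 1), h n, sub_eq_iff_eq_add, sub_eq_iff_eq_add,
    add_comm (1 : Fin (k + 2)) w, add_left_inj, add_comm (1 : Fin (k + 2)), eq_comm]

variable {Ω : Type*} [MeasurableSpace Ω] {P : Measure Ω} [IsProbabilityMeasure P]
  {N : Fin k → ℝ≥0 → Ω → ℕ} {M : ℝ≥0 → Ω → Fin k → ℝ}

/-- Next to two consecutive empty sites the following site is almost surely empty too. Going around
the cycle empties every site, contradicting positive total mass. -/
theorem IsMeteorProcess.ae_edgePos (hM : IsMeteorProcess (SimpleGraph.cycleGraph k) P N M)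
    (hk : 2 ≤ k) (hmass : ∀ᵐ ω ∂P, 0 < ∑ v, M 0 ω v) (hstat : IsStationaryRegime P M) :
    ∀ᵐ ω ∂P, ∀ v w, (SimpleGraph.cycleGraph k).Adj v w → EdgePos v w (M 0 ω) := by
  have htriple : ∀ᵐ ω ∂P, ∀ n : ℕ, ¬ (0 < M 0 ω (site k (n + 2)) ∧ M 0 ω (site k (n + 1)) = 0 ∧
      M 0 ω (site k n) = 0) := by
    rw [ae_all_iff]
    intro n
    exact hM.ae_not_pos_zero_zero hstat ((cycleGraph_adj_site_iff hk n _).2 (Or.inr rfl))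
      ((cycleGraph_adj_site_iff hk n _).2 (Or.inl rfl))
  filter_upwards [htriple, hmass, hM.initial_nonneg] with ω h1 h2 h3
  have hprop : ∀ n, M 0 ω (site k n) = 0 → M 0 ω (site k (n + 1)) = 0 → False := by
    intro n h4 h5
    have hall : ∀ r, M 0 ω (site k (n + r)) = 0 ∧ M 0 ω (site k (n + r + 1)) = 0 := by
      intro r
      induction r with
      | zero => exact ⟨h4, h5⟩
      | succ r ih =>
        refine ⟨ih.2, ?_⟩
        by_contra h6
        exact h1 (n + r) ⟨lt_of_le_of_ne (h3 _) (Ne.symm h6), ih.2, ih.1⟩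
    refine h2.ne' (Finset.sum_eq_zero fun v _ => ?_)
    -- The offset is chosen so that the label is `v + k * n`, congruent to `v` modulo `k`, while
    -- being at least `n`.
    have hv : site k (n + (n * (k - 1) + v)) = v := by
      have hk0 : n + (n * (k - 1) + v) = v + k * n := by
        obtain ⟨k, rfl⟩ : ∃ k', k = k' + 1 := ⟨k - 1, by omega⟩
        simp; ring
      rw [hk0]
      exact Fin.ext ((Nat.add_mul_mod_self_left _ _ _).trans (Nat.mod_eq_of_lt v.2))
    rw [← hv]
    exact (hall _).1
  intro v w hvw
  refine ⟨h3, lt_of_le_of_ne (add_nonneg (h3 v) (h3 w)) fun h4 => ?_⟩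
  have hv : M 0 ω v = 0 := by linarith [h3 v, h3 w]
  have hw : M 0 ω w = 0 := by linarith [h3 v, h3 w]
  have hnext : ∀ v w : Fin k, (SimpleGraph.cycleGraph k).Adj v w →
      w = site k (v + 1) ∨ v = site k (w + 1) := by
    intro v w hvw
    obtain ⟨k, rfl⟩ : ∃ k', k = k' + 2 := ⟨k - 2, by omega⟩
    have h : ∀ v : Fin (k + 2), site (k + 2) (v + 1) = v + 1 := fun v => by
      ext; simp [site, Fin.val_add]
    rw [h, h]
    rw [SimpleGraph.cycleGraph_adj, sub_eq_iff_eq_add', sub_eq_iff_eq_add'] at hvw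
    exact hvw.symm
  rcases hnext v w hvw with h | h
  · exact hprop v (by rwa [site_val]) (h ▸ hw)
  · exact hprop w (by rwa [site_val]) (h ▸ hv)

theorem measurableSet_craterGaps (i j : ℕ) : MeasurableSet (craterGaps k i j) := by
  have h0 : ∀ n, MeasurableSet {m : Fin k → ℝ | m (site k n) = 0} := fun n =>
    measurableSet_eq_fun (measurable_pi_apply _) measurable_const
  have h1 : ∀ a b, MeasurableSet {m : Fin k → ℝ | ∀ n, a ≤ n → n ≤ b → 0 < m (site k n)} := by
    intro a b
    simp only [Set.ofPred_forall]
    exact MeasurableSet.iInter fun n => MeasurableSet.iInter fun _ => MeasurableSet.iInter fun _ =>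
      measurableSet_lt measurable_const (measurable_pi_apply _)
  exact (h0 _).inter ((h0 _).inter ((h0 _).inter ((h1 _ _).inter (h1 _ _))))

/-- The last hits up to time `t` of the sites `1, …, n`. -/
noncomputable def siteLastHit (N : Fin k → ℝ≥0 → Ω → ℕ) (n : ℕ) (t : ℝ≥0) (ω : Ω) (a : Fin n) :
    ℝ≥0 :=
  lastHit t fun s => N (site k (a + 1)) s ω

/-- The positions, among the vertices `1, …, i + j + 5` counted from `0`, of the three craters. -/
def craterPositions (i j q : ℕ) : Prop := q = 1 ∨ q = i + 2 ∨ q = i + j + 3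

/-- If the last hits of the sites are distinct then the craters are the peaks of their order. -/
theorem mem_craterGaps_iff_hasPeaks {i j n : ℕ} (hn : n = i + j + 5)
    {N : Fin k → ℝ≥0 → ℕ} {m : ℝ≥0 → Fin k → ℝ}
    (hk : 2 ≤ k) (h : FollowsHits (SimpleGraph.cycleGraph k) N m)
    (hN : ∀ v, IsCountingPath (N v))
    (h0 : ∀ v w, (SimpleGraph.cycleGraph k).Adj v w → EdgePos v w (m 0)) {t : ℝ≥0}
    {σ : Equiv.Perm (Fin n)}
    (hσ : (fun a : Fin n => lastHit t (N (site k (a + 1)))) ∈ orderCone ℝ≥0 σ) :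
    m t ∈ craterGaps k i j ↔
      HasPeaks (craterPositions i j) 0 (List.ofFn fun a => (σ.symm a : ℕ)) := by
  subst hn
  set x : Fin (i + j + 5) → ℝ≥0 := fun a => lastHit t (N (site k (a + 1))) with hx
  -- `σ` lists the positions in increasing order of last hit, so `σ.symm a` is the rank of position
  -- `a`.
  have hlt : ∀ a b, x a < x b ↔ σ.symm a < σ.symm b := fun a b => by
    have := StrictMono.lt_iff_lt hσ (a := σ.symm a) (b := σ.symm b)
    simpa using this
  -- Coordinate `q + 1` belongs to site `q + 2`. The outermost sites `1` and `i + j + 5` enter only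
  -- as neighbors.
  have hcrater : ∀ q (hq : q + 2 < i + j + 5),
      (m t (site k (q + 2)) = 0 ↔ x ⟨q, by omega⟩ < x ⟨q + 1, by omega⟩ ∧
        x ⟨q + 2, hq⟩ < x ⟨q + 1, by omega⟩) ∧ 0 ≤ m t (site k (q + 2)) := by
    intro q hq
    have hadj : (SimpleGraph.cycleGraph k).Adj (site k (q + 2)) (site k (q + 1)) :=
      (cycleGraph_adj_site_iff hk (q + 1) _).2 (Or.inl rfl)
    have hadj' : (SimpleGraph.cycleGraph k).Adj (site k (q + 2)) (site k (q + 3)) :=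
      (cycleGraph_adj_site_iff hk (q + 1) _).2 (Or.inr rfl)
    refine ⟨⟨fun hz => ?_, fun ⟨h1, h2⟩ => ?_⟩, (h.edgePos hN hadj (h0 _ _ hadj) t).1 _⟩
    · have hne : ∀ a b, a ≠ b → x a ≠ x b := fun a b hab h =>
        hab (injective_of_mem_orderCone hσ h)
      constructor
      · refine lt_of_le_of_ne (le_of_not_gt fun hgt => ?_) (hne _ _ (by simp))
        exact (h.pos hN h0 hadj hgt).ne' hz
      · refine lt_of_le_of_ne (le_of_not_gt fun hgt => ?_) (hne _ _ (by simp))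
        exact (h.pos hN h0 hadj' hgt).ne' hz
    · refine h.eq_zero hN (lt_of_le_of_lt zero_le h1) fun w hw => ?_
      rcases (cycleGraph_adj_site_iff hk (q + 1) _).1 hw with rfl | rfl
      · exact h1
      · exact h2
  have hpeaks : HasPeaks (craterPositions i j) 0 (List.ofFn fun a => (σ.symm a : ℕ)) ↔
      ∀ q, q + 2 < i + j + 5 → (m t (site k (q + 2)) = 0 ↔ craterPositions i j (q + 1)) := by
    unfold HasPeaks
    rw [List.length_ofFn]
    refine forall_congr' fun q => forall_congr' fun hq => ?_
    have hget : ∀ b (hb : b < i + j + 5), (List.ofFn fun a => (σ.symm a : ℕ)).getD b 0 =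
        (σ.symm ⟨b, hb⟩ : ℕ) := fun b hb => by
      rw [List.getD_eq_getElem _ _ (by rwa [List.length_ofFn]), List.getElem_ofFn]
    rw [hget q (by omega), hget (q + 1) (by omega), hget (q + 2) hq, (hcrater q hq).1, hlt, hlt,
      zero_add]
    rfl
  rw [hpeaks]
  unfold craterPositions
  constructor
  · rintro ⟨c1, c2, c3, c4, c5⟩ q hq
    constructor
    · intro hz
      by_contra hne
      rcases le_or_gt (q + 2) (i + 2) with h1 | h1
      · exact (c4 (q + 2) (by omega) h1).ne' hz
      · exact (c5 (q + 2) (by omega) (by omega)).ne' hz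
    · rintro (h1 | h1 | h1)
      · obtain rfl : q = 0 := by omega
        exact c1
      · obtain rfl : q = i + 1 := by omega
        exact c2
      · obtain rfl : q = i + j + 2 := by omega
        exact c3
  · intro H
    refine ⟨(H 0 (by omega)).2 (by omega), (H (i + 1) (by omega)).2 (by omega),
      (H (i + j + 2) (by omega)).2 (by omega), fun n h1 h2 => ?_, fun n h1 h2 => ?_⟩
    all_goals
      obtain ⟨q, rfl⟩ : ∃ q, n = q + 2 := ⟨n - 2, by omega⟩
      refine lt_of_le_of_ne (hcrater q (by omega)).2 fun hz => ?_
      have := (H q (by omega)).1 hz.symm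
      omega

theorem IsMeteorProcess.factorial_mul_craterGaps
    (hM : IsMeteorProcess (SimpleGraph.cycleGraph k) P N M)
    (hmass : ∀ᵐ ω ∂P, 0 < ∑ v, M 0 ω v) (hstat : IsStationaryRegime P M) {i j n : ℕ}
    (hn : n = i + j + 5) (hk : n ≤ k) (s : Finset (Equiv.Perm (Fin n)))
    (hs : ∀ σ, σ ∈ s ↔ HasPeaks (craterPositions i j) 0 (List.ofFn fun a => (σ.symm a : ℕ))) :
    (n.factorial : ℝ) * P.real {ω | M 0 ω ∈ craterGaps k i j} = s.card := by
  have hsite : Function.Injective fun a : Fin n => site k (a + 1) := fun a b hab => by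
    have := site_inj_of_le (by omega) (by omega) (by omega) (by omega) hab
    exact Fin.ext (by omega)
  have hn0 : 0 < n := by omega
  -- The left side does not depend on `t`, so an error bound vanishing as `t` grows forces equality.
  have hbound : ∀ t : ℝ≥0, |(n.factorial : ℝ) * P.real {ω | M 0 ω ∈ craterGaps k i j} - s.card| ≤
      (n.factorial + s.card) * ((n * n) * Real.exp (-t)) := by
    intro t
    set X : Ω → Fin n → ℝ≥0 := siteLastHit N n t with hX
    have hXm : ∀ a, Measurable fun ω => X ω a := fun a => hM.measurable_lastHit_comp t _
    have hXm' : Measurable X := measurable_pi_lambda _ hXm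
    set ν := P.map fun ω => X ω ⟨0, hn0⟩ with hν
    have : IsProbabilityMeasure ν := Measure.isProbabilityMeasure_map (hXm _).aemeasurable
    have hlaw : P.map X = Measure.pi fun _ => ν := by
      have hind : iIndepFun (fun a ω => X ω a) P := (hM.iIndepFun_lastHit t).precomp hsite
      rw [iIndepFun_iff_map_fun_eq_pi_map fun a => (hXm a).aemeasurable] at hind
      refine hind.trans (congrArg Measure.pi (funext fun a => ?_))
      exact hM.map_lastHit_eq t _ _
    set B : Set (Fin n → ℝ≥0) := ⋃ σ ∈ s, orderCone ℝ≥0 σ with hB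
    set I : Set (Fin n → ℝ≥0) := {x | Function.Injective x} with hI
    have hBm : MeasurableSet B := s.measurableSet_biUnion fun σ _ => measurableSet_orderCone σ
    have hIm : MeasurableSet I := by
      rw [hI, ← iUnion_orderCone]
      exact MeasurableSet.iUnion fun σ => measurableSet_orderCone σ
    have hcount := factorial_mul_pi_orderCones ν s
    rw [← hlaw, map_measureReal_apply hXm' hBm, map_measureReal_apply hXm' hIm] at hcount
    have hstat' : P.real {ω | M 0 ω ∈ craterGaps k i j} = P.real {ω | M t ω ∈ craterGaps k i j} :=
      congrArg ENNReal.toReal ((hstat t).measure_mem_eq (measurableSet_craterGaps i j)).symm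
    have hae : ∀ᵐ ω ∂P, X ω ∈ I → (M t ω ∈ craterGaps k i j ↔ X ω ∈ B) := by
      filter_upwards [hM.ae_isCountingPath, hM.evolution, hM.ae_edgePos (by omega) hmass hstat]
        with ω h1 h2 h3 h4
      rw [hI, ← iUnion_orderCone, Set.mem_iUnion] at h4
      obtain ⟨σ, hσ⟩ := h4
      rw [mem_craterGaps_iff_hasPeaks hn (by omega) h2 h1 h3 hσ, ← hs, hB, Set.mem_iUnion₂]
      refine ⟨fun h => ⟨σ, h, hσ⟩, ?_⟩
      rintro ⟨τ, hτ, hτ'⟩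
      by_cases hστ : σ = τ
      · rwa [hστ]
      · exact absurd hτ' (Set.disjoint_left.1 (disjoint_orderCone hστ) hσ)
    have hBI : B ⊆ I := by
      rw [hI, ← iUnion_orderCone]
      exact Set.iUnion₂_subset fun σ _ => Set.subset_iUnion (orderCone ℝ≥0) σ
    have hties : P.real (X ⁻¹' Iᶜ) ≤ n * n * Real.exp (-t) := by
      have hsub : X ⁻¹' Iᶜ ⊆ ⋃ p ∈ (Finset.univ : Finset (Fin n × Fin n)).filter
          (fun p => p.1 ≠ p.2), {ω | X ω p.1 = X ω p.2} := by
        intro ω hω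
        have : ¬ Function.Injective (X ω) := hω
        simp only [Function.Injective, not_forall] at this
        obtain ⟨a, b, hab, hne⟩ := this
        simp only [Set.mem_iUnion]
        exact ⟨(a, b), by simpa using hne, hab⟩
      refine (measureReal_mono hsub (measure_ne_top _ _)).trans
        ((measureReal_biUnion_finset_le _ _).trans ?_)
      refine (Finset.sum_le_card_nsmul _ _ (Real.exp (-t)) fun p hp => ?_).trans ?_
      · refine ENNReal.toReal_le_of_le_ofReal (Real.exp_pos _).le ?_
        exact hM.measure_lastHit_eq_lastHit_le t fun h => (Finset.mem_filter.1 hp).2 (hsite h)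
      · rw [nsmul_eq_mul]
        refine mul_le_mul_of_nonneg_right ?_ (Real.exp_pos _).le
        have := Finset.card_filter_le (Finset.univ : Finset (Fin n × Fin n)) (fun p => p.1 ≠ p.2)
        rw [Finset.card_univ, Fintype.card_prod, Fintype.card_fin] at this
        exact_mod_cast this
    have hcompl : P.real (X ⁻¹' I) = 1 - P.real (X ⁻¹' Iᶜ) := by
      rw [Set.preimage_compl, probReal_compl_eq_one_sub (hXm' hIm)]; ring
    have hle : P.real (X ⁻¹' B) ≤ P.real {ω | M t ω ∈ craterGaps k i j} := by
      refine ENNReal.toReal_mono (measure_ne_top _ _) (measure_mono_ae ?_)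
      filter_upwards [hae] with ω h1 h2
      exact (h1 (hBI h2)).2 h2
    have hge : P.real {ω | M t ω ∈ craterGaps k i j} ≤
        P.real (X ⁻¹' B) + P.real (X ⁻¹' Iᶜ) := by
      refine le_trans ?_ (measureReal_union_le _ _)
      refine ENNReal.toReal_mono (measure_ne_top _ _) (measure_mono_ae ?_)
      filter_upwards [hae] with ω h1 h2
      by_cases h3 : X ω ∈ I
      · exact Or.inl ((h1 h3).1 h2)
      · exact Or.inr h3
    rw [hstat']
    rw [hcompl] at hcount
    generalize P.real (X ⁻¹' B) = b at *
    generalize P.real {ω | M t ω ∈ craterGaps k i j} = p at *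
    have hd0 : 0 ≤ P.real (X ⁻¹' Iᶜ) := measureReal_nonneg
    generalize P.real (X ⁻¹' Iᶜ) = d at *
    have hf : (0 : ℝ) ≤ n.factorial := Nat.cast_nonneg _
    have hc : (0 : ℝ) ≤ s.card := Nat.cast_nonneg _
    generalize (n.factorial : ℝ) = F at *
    generalize (s.card : ℝ) = C at *
    -- With `d` the probability of a tie, `F * b = C * (1 - d)` and `b ≤ p ≤ b + d`, so `F * p` and
    -- `C` differ by at most `(F + C) * d`.
    have e1 : F * b ≤ F * p := mul_le_mul_of_nonneg_left hle hf
    have e2 : F * p ≤ F * (b + d) := mul_le_mul_of_nonneg_left hge hf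
    have e3 : (F + C) * d ≤ (F + C) * (n * n * Real.exp (-t)) :=
      mul_le_mul_of_nonneg_left hties (by linarith)
    have e4 := mul_nonneg hf hd0
    have e5 := mul_nonneg hc hd0
    rw [abs_le]
    constructor <;> nlinarith
  have hlim : Tendsto (fun t : ℝ≥0 => (n.factorial + s.card : ℝ) * ((n * n) * Real.exp (-t)))
      atTop (𝓝 ((n.factorial + s.card : ℝ) * ((n * n) * 0))) := by
    refine Tendsto.const_mul _ (Tendsto.const_mul _ ?_)
    exact Real.tendsto_exp_neg_atTop_nhds_zero.comp (NNReal.tendsto_coe_atTop.2 tendsto_id)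
  have := ge_of_tendsto' hlim hbound
  rw [mul_zero, mul_zero] at this
  exact sub_eq_zero.1 (abs_nonpos_iff.1 this)

end Cycle

end Meteor

/-! ### Conclusion -/

theorem theorem4p2 {Ω : Type*} [MeasurableSpace Ω] (P : Measure Ω) [IsProbabilityMeasure P]
    (k : ℕ) [NeZero k] (i j : ℕ) (hi : 1 ≤ i) (hj : 1 ≤ j) (hk : i + j + 5 ≤ k)
    (N : Fin k → ℝ≥0 → Ω → ℕ) (M : ℝ≥0 → Ω → Fin k → ℝ)
    (hM : Meteor.IsMeteorProcess (SimpleGraph.cycleGraph k) P N M)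
    (hmass : ∀ᵐ ω ∂P, ∑ v, M 0 ω v = (k : ℝ))
    (hstat : Meteor.IsStationaryRegime P M) :
    P.real {ω | M 0 ω ∈ Meteor.craterGaps k i j} =
      (2 : ℝ) ^ (i + j) / ((i + j + 5).factorial : ℝ) *
        (((i : ℝ) + j + 4) *
            ((j : ℝ) * ((i + j + 1).choose (i - 1) : ℝ)
              + ((j : ℝ) + 1) * ((i + j + 1).choose i : ℝ)
              + ((i : ℝ) + 1) * ((i + j + 1).choose (i + 1) : ℝ)
              + (i : ℝ) * ((i + j + 1).choose (i + 2) : ℝ)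
              - 2 * ((i : ℝ) + j + 1))
          + (i : ℝ) * (j : ℝ) * ((i + j + 4).choose (i + 2) : ℝ)) := by
  classical
  have hpos : ∀ᵐ ω ∂P, 0 < ∑ v, M 0 ω v := by
    filter_upwards [hmass] with ω hω
    rw [hω]
    exact Nat.cast_pos.2 (NeZero.pos k)
  have hmain := hM.factorial_mul_craterGaps hpos hstat rfl hk
    (Finset.univ.filter fun σ => HasPeaks (Meteor.craterPositions i j) 0
      (List.ofFn fun a => (σ.symm a : ℕ))) (by simp)
  -- The permutation count is parametrized by gap sizes `i + 1` and `j + 1`, which avoids truncated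
  -- subtraction.
  obtain ⟨i, rfl⟩ : ∃ i', i = i' + 1 := ⟨i - 1, by omega⟩
  obtain ⟨j, rfl⟩ : ∃ j', j = j' + 1 := ⟨j - 1, by omega⟩
  have hcard := card_perm_three_peaks i j (i + 1 + (j + 1) + 5) (by ring)
  have hpat : Meteor.craterPositions (i + 1) (j + 1) =
      fun q => q = 1 ∨ q = i + 3 ∨ q = i + j + 5 := by
    funext q
    simp only [Meteor.craterPositions, eq_iff_iff]
    omega
  -- The probabilistic side counts sorting permutations through their inverses; inversion is a
  -- bijection, so the number is the same.
  have hinv : (Finset.univ.filter fun σ : Equiv.Perm (Fin (i + 1 + (j + 1) + 5)) =>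
      HasPeaks (Meteor.craterPositions (i + 1) (j + 1)) 0
        (List.ofFn fun a => (σ.symm a : ℕ))).card =
      (Finset.univ.filter fun σ : Equiv.Perm (Fin (i + 1 + (j + 1) + 5)) =>
        HasPeaks (fun q => q = 1 ∨ q = i + 3 ∨ q = i + j + 5) 0
          (List.ofFn fun a => (σ a : ℕ))).card := by
    rw [hpat]
    refine Finset.card_equiv (Equiv.inv _) fun σ => ?_
    simp only [Finset.mem_filter, Finset.mem_univ, true_and, Equiv.inv_apply]
    rfl
  rw [hinv] at hmain
  have hcard' := congrArg (fun q : ℚ => (q : ℝ)) hcard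
  simp only [Rat.cast_natCast] at hcard'
  rw [hcard'] at hmain
  have hF : ((i + 1 + (j + 1) + 5).factorial : ℝ) ≠ 0 :=
    Nat.cast_ne_zero.2 (Nat.factorial_ne_zero _)
  rw [div_mul_eq_mul_div, eq_div_iff hF, mul_comm, hmain]
  rw [show i + 1 - 1 = i by omega, show i + 1 + (j + 1) + 1 = i + j + 3 by ring,
    show i + 1 + (j + 1) + 4 = i + j + 6 by ring, show i + 1 + (j + 1) = i + j + 2 by ring,
    show i + 1 + 1 = i + 2 by ring, show i + 1 + 2 = i + 3 by ring]
  push_cast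
  ring
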